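/- Let $\Omega\subset\mathbb R^2$ be a polygonal connected bounded open set, lying on one side of its boundary (i.e. $\Omega=\operatorname{int}\overline\Omega$ and $\partial\Omega$ is a finite union of segments). **Mesh.** An admissible mesh of $\Omega$ consists of finitely many open convex polygonal control volumes $K\subset\Omega$, $K\in\mathcal T$, of finitely many pairwise disjoint open segments $\sigma\in\mathcal E$ of positive length (the edges), and of points $x_K\in K$, such that: $\overline{\bigcup_K K}=\overline\Omega$; $\partial K=\bigcup_{\sigma\in\mathcal E_K}\overline\sigma$ with $\mathcal E_K=\{\sigma\in\mathcal E:\sigma\subset\partial K\}$, and $\mathcal E=\bigcup_K\mathcal E_K$; for $K\ne L$, either $\overline K\cap\overline L$ has zero length or $\overline K\cap\overline L=\overline\sigma$ for some $\sigma\in\mathcal E$, denoted $\sigma=K|L$, and then the line through $x_K,x_L$ is orthogonal to $\sigma$; for $\sigma\in\mathcal E_K$ with $\sigma\subset\partial\Omega$, the line through $x_K$ orthogonal to $\sigma$ meets $\overline\sigma$. Let $m_K$ be the area of $K$, $m_\sigma$ the length of $\sigma$, $d(x_K,\sigma)$ the distance from $x_K$ to the line containing $\sigma$, $d_\sigma=|x_K-x_L|$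 if $\sigma=K|L$ and $d_\sigma=d(x_K,\sigma)$ if $\sigma\in\mathcal E_K$ lies in $\partial\Omega$, and $\tau_\sigma=m_\sigma/d_\sigma$. The mesh is $\zeta$-regular, $\zeta>0$, if $d(x_K,\sigma)\ge\zeta d_\sigma$ for all $K\in\mathcal T$ and $\sigma\in\mathcal E_K$. **Scheme.** Let $V\in C^1(\overline\Omega)$ and $u_0\in L^2(\Omega)$ with $u_0\ge0$ and $M^1:=\int_\Omega u_0>0$. Let $r:(0,\infty)^2\to(0,\infty)$ be nondecreasing in each variable, symmetric and positively $1$-homogeneous, with $r(x,x)=x$ and $\frac{x-y}{\log x-\log y}\le r(x,y)\le\max(x,y)$ for $x\ne y$. For $w\in(0,\infty)^{\mathcal T}$ put $$F_{K,\sigma}(w)=-\tau_\sigma\, r(w_K,w_L)\big(\log w_L+V(x_L)-\log w_K-V(x_K)\big)\ \text{ if }\sigma=K|L,\qquad F_{K,\sigma}(w)=0\ \text{ if }\sigma\subset\partial\Omega .$$ A solution of the nonlinear two-point flux approximation (TPFA) scheme with no-flux boundary conditions and time step $\Delta t>0$ is a sequence $(u^n)_{n\ge0}$ in $\mathbb R^{\mathcal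 T}$ with $u^0_K=\frac1{m_K}\int_K u_0$, with $u^{n}_K>0$ for $n\ge1$, and with $$m_K\frac{u_K^{n+1}-u_K^n}{\Delta t}+\sum_{\sigma\in\mathcal E_K}F_{K,\sigma}(u^{n+1})=0\qquad(K\in\mathcal T,\ n\ge0).$$ The steady state is the vector $u^\infty\in(0,\infty)^{\mathcal T}$ with $\sum_{\sigma\in\mathcal E_K}F_{K,\sigma}(u^\infty)=0$ for all $K$ and $\sum_K m_Ku^\infty_K=M^1$. Let $0<m^\infty\le u^\infty_K\le M^\infty$ for all $K\in\mathcal T$. With $\Phi_1(s)=s\log s-s+1$ (where $0\log0=0$) and $\Phi_2(s)=s^2-2s+1$, set $\mathbb E_p^0=\sum_K m_Ku_K^\infty\,\Phi_p(u_K^0/u_K^\infty)$ for $p=1,2$. **Claim.** There are positive numbers $\nu_1=\nu_1(\zeta,M^1,m^\infty,M^\infty)$ and $\nu_2=\nu_2(\zeta,m^\infty/M^\infty)$, which apart from the indicated quantities depend only on $\Omega$, such that for every $\zeta$-regular admissible mesh, all data $V,u_0,r$ as above, every $k>0$, every time step $0<\Delta t\le k$ and every solution $(u^n)$ of the scheme,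 with $\tilde\nu_p=\log(1+\nu_pk)/k$ and $t^n=n\Delta t$, one has for all $n\ge0$ $$\sum_{K\in\mathcal T}m_K|u_K^n-u_K^\infty|^2\le\mathbb E_2^0\,M^\infty e^{-\tilde\nu_2t^n},\qquad \Big(\sum_{K\in\mathcal T}m_K|u_K^n-u_K^\infty|\Big)^2\le2\,\mathbb E_1^0\,M^1e^{-\tilde\nu_1t^n}.$$ -/

import Mathlib

open MeasureTheory

noncomputable section

namespace TPFA

/-- The Euclidean plane. -/
abbrev Plane : Type := EuclideanSpace ℝ (Fin 2)

/-- Polygonal connected bounded open subsets of the plane: the boundary is a finite union of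
segments, and `Ω` lies on one side of its boundary (no slits), i.e. `Ω` is the interior of its
closure. -/
structure IsPolygonalDomain (Ω : Set Plane) : Prop where
  isOpen : IsOpen Ω
  isConnected : IsConnected Ω
  isBounded : Bornology.IsBounded Ω
  interior_closure : interior (closure Ω) = Ω
  frontier_eq : ∃ s : Finset (Plane × Plane), frontier Ω = ⋃ p ∈ s, segment ℝ p.1 p.2

/-- Admissible finite volume mesh of `Ω` with control volumes indexed by `ι` and edges indexed
by `κ`. Edges are (relatively) open segments, pairwise disjoint. The set of edges of a
control volume consists of the edges contained in its boundary; as this boundary is a union of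
closed edges, each (convex) control volume is a polygon. -/
structure AdmissibleMesh (Ω : Set Plane) (ι κ : Type) where
  /-- the control volumes -/
  cell : ι → Set Plane
  /-- the edges -/
  edge : κ → Set Plane
  /-- the centers `x_K` -/
  center : ι → Plane
  cell_isOpen : ∀ K, IsOpen (cell K)
  cell_convex : ∀ K, Convex ℝ (cell K)
  cell_subset : ∀ K, cell K ⊆ Ω
  center_mem : ∀ K, center K ∈ cell K
  edge_segment : ∀ σ, ∃ a b : Plane, a ≠ b ∧ edge σ = openSegment ℝ a b
  edge_disjoint : ∀ σ σ', σ ≠ σ' → Disjoint (edge σ) (edge σ')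
  /-- the closed control volumes cover the closed domain -/
  closure_iUnion : closure (⋃ K, cell K) = closure Ω
  /-- the boundary of a control volume is the union of its closed edges -/
  frontier_cell : ∀ K,
    frontier (cell K) = ⋃ σ ∈ {σ | edge σ ⊆ frontier (cell K)}, closure (edge σ)
  /-- each edge is an edge of at least one control volume -/
  edge_mem : ∀ σ, ∃ K, edge σ ⊆ frontier (cell K)
  /-- two distinct closed control volumes meet in a set of zero length or in a full edge -/
  inter_closure : ∀ K L, K ≠ L →
    Measure.hausdorffMeasure 1 (closure (cell K) ∩ closure (cell L)) = 0 ∨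
      ∃ σ, closure (cell K) ∩ closure (cell L) = closure (edge σ)
  /-- the line through `x_K` and `x_L` is orthogonal to the edge `σ = K|L` -/
  orthogonal : ∀ K L σ, K ≠ L →
    closure (cell K) ∩ closure (cell L) = closure (edge σ) →
    ∀ p ∈ edge σ, ∀ q ∈ edge σ, inner ℝ (center K - center L) (p - q) = 0
  /-- the line through `x_K` orthogonal to a boundary edge `σ` of `K` meets the closed edge -/
  foot_mem : ∀ K σ, edge σ ⊆ frontier (cell K) → edge σ ⊆ frontier Ω →
    ∃ y ∈ closure (edge σ), ∀ p ∈ edge σ, ∀ q ∈ edge σ, inner ℝ (center K - y) (p - q) = 0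

namespace AdmissibleMesh

variable {Ω : Set Plane} {ι κ : Type} (𝓜 : AdmissibleMesh Ω ι κ)

/-- `σ = K|L`: the edge `σ` is the interface between the distinct control volumes `K`, `L`. -/
def IsInterface (K L : ι) (σ : κ) : Prop :=
  K ≠ L ∧ closure (𝓜.cell K) ∩ closure (𝓜.cell L) = closure (𝓜.edge σ)

open Classical in
/-- The set `ℰ_K` of the edges of `K`. -/
def edges [Fintype κ] (K : ι) : Finset κ :=
  Finset.univ.filter fun σ => 𝓜.edge σ ⊆ frontier (𝓜.cell K)

/-- The area `m_K`. -/
def area (K : ι) : ℝ := volume.real (𝓜.cell K)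

/-- The length `m_σ`, i.e. the one-dimensional Hausdorff measure of `σ`. -/
def length (σ : κ) : ℝ := (Measure.hausdorffMeasure 1 : Measure Plane).real (𝓜.edge σ)

/-- `d(x_K, σ)`: distance from `x_K` to the line containing `σ`. -/
def distEdge (K : ι) (σ : κ) : ℝ :=
  Metric.infDist (𝓜.center K) (affineSpan ℝ (𝓜.edge σ) : Set Plane)

open Classical in
/-- The control volume on the other side of the edge `σ` of `K`: it is `L` if `σ = K|L`, and
`K` itself if `σ` is a boundary edge (all boundary edges are no-flux edges). -/
def nbr (K : ι) (σ : κ) : ι :=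
  if h : ∃ L, 𝓜.IsInterface K L σ then h.choose else K

open Classical in
/-- `d_σ` for an edge `σ` of `K`: `d(x_K, x_L)` if `σ = K|L`, and `d(x_K, σ)` if `σ` is a
boundary edge. -/
def dSigma (K : ι) (σ : κ) : ℝ :=
  if ∃ L, 𝓜.IsInterface K L σ then dist (𝓜.center K) (𝓜.center (𝓜.nbr K σ))
  else 𝓜.distEdge K σ

/-- The transmissibility `τ_σ = m_σ / d_σ` for an edge `σ` of `K`. -/
def trans (K : ι) (σ : κ) : ℝ := 𝓜.length σ / 𝓜.dSigma K σ

/-- Regularity of the mesh: `d(x_K, σ) ≥ ζ d_σ` for all `K` and all edges `σ` of `K`. -/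
def IsRegular [Fintype κ] (ζ : ℝ) : Prop :=
  ∀ K, ∀ σ ∈ 𝓜.edges K, ζ * 𝓜.dSigma K σ ≤ 𝓜.distEdge K σ

/-- The difference operator `D_{K,σ} w = w_{K,σ} - w_K`, where `w_{K,σ} = w_L` if `σ = K|L`,
and `w_{K,σ} = w_K` if `σ` is a (no-flux) boundary edge. -/
def diff (w : ι → ℝ) (K : ι) (σ : κ) : ℝ := w (𝓜.nbr K σ) - w K

/-- The numerical flux `F_{K,σ} = -τ_σ r(w_K, w_L) D_{K,σ}(log w + V)` for `σ = K|L`; it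
vanishes if `σ` is a boundary edge. -/
def flux (r : ℝ → ℝ → ℝ) (V : Plane → ℝ) (w : ι → ℝ) (K : ι) (σ : κ) : ℝ :=
  -(𝓜.trans K σ * r (w K) (w (𝓜.nbr K σ)) *
    𝓜.diff (fun J => Real.log (w J) + V (𝓜.center J)) K σ)

/-- `u` is a solution of the nonlinear TPFA scheme with no-flux boundary conditions, time step
`Δt` and initial datum `u₀`. The initial values may vanish in some control volumes; the
later ones are positive, so that `log u` and `r` are evaluated in their domain. -/
structure IsSolution [Fintype κ] (r : ℝ → ℝ → ℝ) (V u₀ : Plane → ℝ) (Δt : ℝ)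
    (u : ℕ → ι → ℝ) : Prop where
  init : ∀ K, u 0 K = (1 / 𝓜.area K) * ∫ x in 𝓜.cell K, u₀ x
  pos : ∀ n K, 0 < u (n + 1) K
  scheme : ∀ n K, 𝓜.area K * ((u (n + 1) K - u n K) / Δt) +
    ∑ σ ∈ 𝓜.edges K, 𝓜.flux r V (u (n + 1)) K σ = 0

/-- `uInf` is a (positive) steady state of the scheme with no-flux boundary conditions, with
the same mass as the initial datum `u₀`. -/
structure IsSteadyState [Fintype ι] [Fintype κ] (r : ℝ → ℝ → ℝ) (V u₀ : Plane → ℝ)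
    (uInf : ι → ℝ) : Prop where
  pos : ∀ K, 0 < uInf K
  stationary : ∀ K, ∑ σ ∈ 𝓜.edges K, 𝓜.flux r V uInf K σ = 0
  mass : ∑ K, 𝓜.area K * uInf K = ∫ x in Ω, u₀ x

/-- The discrete relative entropy `∑_K m_K u_K^∞ Φ(w_K / u_K^∞)`. -/
def entropy [Fintype ι] (Φ : ℝ → ℝ) (uInf w : ι → ℝ) : ℝ :=
  ∑ K, 𝓜.area K * uInf K * Φ (w K / uInf K)

end AdmissibleMesh

/-- Generator of the Boltzmann-Gibbs entropy, `Φ₁(s) = s log s - s + 1` (with `0 log 0 = 0`). -/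
def Φ₁ (s : ℝ) : ℝ := s * Real.log s - s + 1

/-- Generator of the Tsallis entropies, `Φ_p(s) = (s^p - p s)/(p - 1) + 1` for `1 < p ≤ 2`. -/
def Φ (p s : ℝ) : ℝ := (s ^ p - p * s) / (p - 1) + 1

/-- The mean functions `r : (0,∞)² → (0,∞)` allowed in the scheme. -/
structure IsMeanFunction (r : ℝ → ℝ → ℝ) : Prop where
  pos : ∀ x y, 0 < x → 0 < y → 0 < r x y
  mono_left : ∀ x x' y, 0 < x → 0 < y → x ≤ x' → r x y ≤ r x' y
  mono_right : ∀ x y y', 0 < x → 0 < y → y ≤ y' → r x y ≤ r x y'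
  diag : ∀ x, 0 < x → r x x = x
  symm : ∀ x y, 0 < x → 0 < y → r x y = r y x
  homogeneous : ∀ c x y, 0 < c → 0 < x → 0 < y → r (c * x) (c * y) = c * r x y
  lower : ∀ x y, 0 < x → 0 < y → x ≠ y → (x - y) / (Real.log x - Real.log y) ≤ r x y
  upper : ∀ x y, 0 < x → 0 < y → x ≠ y → r x y ≤ max x y

/-- `V ∈ C¹(closure Ω)`: `V` is differentiable in the open set `Ω`, and `V` and its derivative
extend continuously to the closure (for `V`, by the values of `V` there). -/
def IsC1Closure (Ω : Set Plane) (V : Plane → ℝ) : Prop :=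
  ContinuousOn V (closure Ω) ∧
    ∃ G : Plane → Plane →L[ℝ] ℝ, ContinuousOn G (closure Ω) ∧ ∀ x ∈ Ω, HasFDerivAt V (G x) x

/-- Admissible initial data: square-integrable, nonnegative and nontrivial. -/
structure IsInitialDatum (Ω : Set Plane) (u₀ : Plane → ℝ) : Prop where
  memLp : MemLp u₀ 2 (volume.restrict Ω)
  nonneg : ∀ᵐ x ∂(volume.restrict Ω), 0 ≤ u₀ x
  mass_pos : 0 < ∫ x in Ω, u₀ x

/-- The rate `ν̃ = log(1 + ν k) / k`. -/
def expRate (ν k : ℝ) : ℝ := Real.log (1 + ν * k) / k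

end TPFA

end

/-!
The relative entropies of `u^n` with respect to the steady state decay geometrically because the
entropy dissipated in one time step dominates the entropy itself. The steady state is a discrete
thermal equilibrium (`IsSteadyState.log_add_eq`), so with `f = u / u^∞` the flux is
`-τ r(u_K, u_L) (log f_L - log f_K)`; convexity of the generator gives the dissipation
(`entropy_add_dissipation_le`), and since `r` dominates the logarithmic mean it is bounded below by
the discrete Dirichlet energy of `f` (for `Φ₂`) or of `√f` (for `Φ₁`). Bernoulli's inequality turns
the factor `1 + ν Δt` per step into the exponential rate, and the entropies control the distances
in `L²` and, by Pinsker's inequality, in `L¹`.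

What is needed is thus a discrete Poincaré inequality and a discrete logarithmic Sobolev inequality
whose constants depend only on `Ω` and `ζ`. Both follow from one Sobolev inequality: there is a
constant `c` with `‖g - c‖_{L⁴} ^ 2 ≤ (B / ζ) ∑ τ_σ |D_σ g| ^ 2`
(`IsPolygonalDomain.exists_sobolev_poincare`). With `c` a median of `g`, a co-area argument reduces
it to the relative isoperimetric inequality `|A| ≤ C (∑_{σ ⊆ ∂A} m_σ) ^ 2` for unions `A` of cells
with `|A| ≤ |Ω| / 2`, applied to the squares of the positive and negative parts of `g - c`; the
Cauchy–Schwarz inequality then brings in `∑_{σ ∈ ℰ_K} m_σ d_σ ≤ const · m_K / ζ`, which is where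
regularity of the mesh enters.

The isoperimetric inequality is proved by integral geometry. A segment that leaves `A` inside `Ω`
crosses an interface between `A` and its complement, and the points from which the translation by
`z` crosses a given edge fill a parallelogram; hence the translation by `z` moves at most
`|z| ∑_{σ ⊆ ∂A} m_σ` of the area of `A` out of `A` (`HasPerimeterBound`). In a convex set, averaging
this over contractions of a suitable ratio gives the inequality with the optimal power
(`volume_inter_le_of_le_half`). A polygonal domain is, up to a null set, a finite union of open
convex sets, namely the cells of the arrangement of lines that carry its boundary, and chains of
overlapping balls transfer the inequality between them (`IsPolygonalDomain.isoperimetricPair`).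
-/

open MeasureTheory

namespace TPFA

/-! ### Crossing and triangle areas in the plane -/

/-- The oriented area `p ∧ q` spanned by two vectors of the plane. -/
def cross (p q : Plane) : ℝ := p 0 * q 1 - p 1 * q 0

lemma norm_sq_eq (p : Plane) : ‖p‖ ^ 2 = p 0 ^ 2 + p 1 ^ 2 := by
  rw [EuclideanSpace.norm_sq_eq]
  simp [Fin.sum_univ_two]

lemma inner_eq (p q : Plane) : inner ℝ p q = p 0 * q 0 + p 1 * q 1 := by
  simp [PiLp.inner_apply, Fin.sum_univ_two, mul_comm]

lemma cross_sq_add_inner_sq (p q : Plane) :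
    cross p q ^ 2 + inner ℝ p q ^ 2 = ‖p‖ ^ 2 * ‖q‖ ^ 2 := by
  rw [norm_sq_eq, norm_sq_eq, inner_eq, cross]
  ring

lemma abs_cross_le (p q : Plane) : |cross p q| ≤ ‖p‖ * ‖q‖ := by
  apply abs_le_of_sq_le_sq _ (by positivity)
  nlinarith [cross_sq_add_inner_sq p q, sq_nonneg (inner ℝ p q : ℝ)]

/-- Two parallel vectors are proportional. -/
lemma exists_smul_of_cross_eq_zero {e v : Plane} (he : e ≠ 0) (h : cross e v = 0) :
    ∃ β : ℝ, v = β • e := by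
  have hn : e 0 ^ 2 + e 1 ^ 2 ≠ 0 := by
    rw [← norm_sq_eq]; simpa using he
  refine ⟨(e 0 * v 0 + e 1 * v 1) / (e 0 ^ 2 + e 1 ^ 2), ?_⟩
  unfold cross at h
  ext i
  fin_cases i
  · simp only [PiLp.smul_apply, smul_eq_mul, Fin.zero_eta, Fin.isValue]
    field_simp
    linear_combination (-e 1) * h
  · simp only [PiLp.smul_apply, smul_eq_mul, Fin.mk_one, Fin.isValue]
    field_simp
    linear_combination (e 0) * h

/-- The linear map with columns `p` and `q`. -/
noncomputable def columnMap (p q : Plane) : Plane →ₗ[ℝ] Plane where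
  toFun e := e 0 • p + e 1 • q
  map_add' x y := by simp only [PiLp.add_apply]; module
  map_smul' c x := by simp only [PiLp.smul_apply, smul_eq_mul, RingHom.id_apply]; module

@[simp] lemma columnMap_apply (p q e : Plane) : columnMap p q e = e 0 • p + e 1 • q := rfl

lemma det_columnMap (p q : Plane) : LinearMap.det (columnMap p q) = cross p q := by
  rw [← LinearMap.det_toMatrix (EuclideanSpace.basisFun (Fin 2) ℝ).toBasis, Matrix.det_fin_two]
  simp [LinearMap.toMatrix_apply, cross, mul_comm]

/-- The closed unit square. -/
def unitSquare : Set Plane := {e | ∀ i, e i ∈ Set.Icc (0 : ℝ) 1}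

lemma volume_unitSquare : volume unitSquare = 1 := by
  have h : unitSquare = (WithLp.ofLp : Plane → Fin 2 → ℝ) ⁻¹' Set.Icc 0 1 := by
    ext e; simp [unitSquare, Pi.le_def, forall_and]
  rw [h, (PiLp.volume_preserving_ofLp (Fin 2)).measure_preimage measurableSet_Icc.nullMeasurableSet,
    Real.volume_Icc_pi]
  simp

/-- The points from which the translation by `z` crosses the segment `[a, b]` fill a
parallelogram with sides `b - a` and `z`. -/
lemma volume_crossing_le (z a b : Plane) :
    volume {x | (segment ℝ x (x + z) ∩ segment ℝ a b).Nonempty} ≤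
      ENNReal.ofReal (‖z‖ * dist a b) := by
  have hsub : {x | (segment ℝ x (x + z) ∩ segment ℝ a b).Nonempty} ⊆
      (fun y => a + y) '' (columnMap (b - a) (-z) '' unitSquare) := by
    rintro x ⟨p, hp, hp'⟩
    rw [segment_eq_image'] at hp hp'
    obtain ⟨s, hs, rfl⟩ := hp
    obtain ⟨α, hα, h⟩ := hp'
    refine ⟨_, ⟨WithLp.toLp 2 ![α, s], ?_, rfl⟩, ?_⟩
    · intro i; fin_cases i
      · simpa using hα
      · simpa using hs
    · simp only [columnMap_apply, Matrix.cons_val_zero, Matrix.cons_val_one]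
      have : x = a + α • (b - a) - s • z := by
        have h' : a + α • (b - a) = x + s • (x + z - x) := h
        rw [h']; simp
      rw [this]; module
  refine (measure_mono hsub).trans ?_
  rw [Set.image_add_left, measure_preimage_add, Measure.addHaar_image_linearMap, volume_unitSquare,
    mul_one, det_columnMap]
  apply ENNReal.ofReal_le_ofReal
  refine (abs_cross_le _ _).trans ?_
  rw [norm_neg, dist_comm, dist_eq_norm, mul_comm]

/-- The open triangle whose vertices are the origin and the standard basis vectors. Only the
positivity of its area matters below. -/
def stdTriangle : Set Plane := {e | 0 < e 0 ∧ 0 < e 1 ∧ e 0 + e 1 < 1}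

lemma isOpen_stdTriangle : IsOpen stdTriangle := by
  simp only [stdTriangle, Set.ofPred_and]
  refine (isOpen_lt ?_ ?_).inter ((isOpen_lt ?_ ?_).inter (isOpen_lt ?_ ?_)) <;> fun_prop

lemma volume_stdTriangle_pos : 0 < volume stdTriangle := by
  refine isOpen_stdTriangle.measure_pos volume ⟨WithLp.toLp 2 ![1 / 3, 1 / 3], ?_⟩
  norm_num [stdTriangle]

lemma volume_stdTriangle_lt_top : volume stdTriangle < ⊤ := by
  refine (measure_mono (?_ : _ ⊆ unitSquare)).trans_lt
    (volume_unitSquare.trans_lt ENNReal.one_lt_top)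
  rintro e ⟨h0, h1, h2⟩ i
  fin_cases i
  · exact ⟨h0.le, by change e 0 ≤ 1; linarith⟩
  · exact ⟨h1.le, by change e 1 ≤ 1; linarith⟩

/-- The open triangle with apex `x` and base `[a, b]`. -/
def triangle (x a b : Plane) : Set Plane :=
  {y | ∃ p ∈ openSegment ℝ a b, y ∈ openSegment ℝ x p}

lemma triangle_eq_image (x a b : Plane) :
    triangle x a b = (fun y => x + y) '' (columnMap (a - x) (b - x) '' stdTriangle) := by
  ext y
  simp only [triangle, Set.mem_ofPred_eq, Set.mem_image]
  constructor
  · rintro ⟨p, hp, hy⟩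
    rw [openSegment_eq_image] at hp hy
    obtain ⟨α, ⟨hα0, hα1⟩, rfl⟩ := hp
    obtain ⟨s, ⟨hs0, hs1⟩, rfl⟩ := hy
    refine ⟨_, ⟨WithLp.toLp 2 ![s * (1 - α), s * α], ⟨?_, ?_, ?_⟩, rfl⟩, ?_⟩
    · simpa using mul_pos hs0 (by linarith : (0 : ℝ) < 1 - α)
    · simpa using mul_pos hs0 hα0
    · simp only [Matrix.cons_val_zero, Matrix.cons_val_one]; nlinarith
    · simp only [columnMap_apply, Matrix.cons_val_zero, Matrix.cons_val_one]
      module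
  · rintro ⟨_, ⟨e, ⟨h0, h1, h2⟩, rfl⟩, rfl⟩
    have hs : 0 < e 0 + e 1 := add_pos h0 h1
    refine ⟨(e 0 / (e 0 + e 1)) • a + (e 1 / (e 0 + e 1)) • b,
      ⟨_, _, by positivity, by positivity, by field_simp, rfl⟩, 1 - (e 0 + e 1), e 0 + e 1,
      by linarith, hs, by ring, ?_⟩
    rw [smul_add, smul_smul, smul_smul, mul_div_cancel₀ _ hs.ne', mul_div_cancel₀ _ hs.ne',
      columnMap_apply]
    module

lemma volume_triangle (x a b : Plane) :
    volume (triangle x a b) = ENNReal.ofReal |cross (a - x) (b - x)| * volume stdTriangle := by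
  rw [triangle_eq_image, Set.image_add_left, measure_preimage_add, Measure.addHaar_image_linearMap,
    det_columnMap]

lemma nullMeasurableSet_triangle {x a b : Plane} :
    NullMeasurableSet (triangle x a b) volume := by
  have h : Convex ℝ stdTriangle := by
    rintro e ⟨h0, h1, h2⟩ f ⟨k0, k1, k2⟩ s t hs ht hst
    have key : ∀ u v : ℝ, 0 < u → 0 < v → 0 < s * u + t * v := fun u v hu hv => by
      rcases hs.eq_or_lt with rfl | hs
      · have : t = 1 := by linarith
        subst this; linarith
      · have := mul_pos hs hu
        have := mul_nonneg ht hv.le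
        linarith
    refine ⟨key _ _ h0 k0, key _ _ h1 k1, ?_⟩
    have := key _ _ (sub_pos.2 h2) (sub_pos.2 k2)
    simp only [PiLp.add_apply, PiLp.smul_apply, smul_eq_mul]
    linarith
  rw [triangle_eq_image]
  exact ((h.linear_image _).translate x).nullMeasurableSet volume

/-- Base times height: the distance from `x` to the line through `a` and `b`, multiplied by the
length of the base, is at most twice the area of the triangle. -/
lemma dist_mul_infDist_le (x : Plane) {a b : Plane} (hab : a ≠ b) :
    dist a b * Metric.infDist x (affineSpan ℝ (openSegment ℝ a b) : Set Plane) ≤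
      |cross (a - x) (b - x)| := by
  set e := b - a with he
  set w := x - a with hw
  have hen : ‖e‖ ≠ 0 := by simpa [he, sub_eq_zero] using hab.symm
  have hd : dist a b = ‖e‖ := by rw [dist_comm, dist_eq_norm]
  set c : ℝ := inner ℝ w e / ‖e‖ ^ 2
  have hfoot : a + c • e ∈ (affineSpan ℝ (openSegment ℝ a b) : Set Plane) := by
    have hp : ∀ s : ℝ, 0 < s → s < 1 → a + s • e ∈ affineSpan ℝ (openSegment ℝ a b) := by
      intro s h0 h1
      apply subset_affineSpan
      rw [openSegment_eq_image']
      exact ⟨s, ⟨h0, h1⟩, rfl⟩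
    have h := AffineMap.lineMap_mem (4 * (c - 1 / 4) * 1) (hp (1/4) (by norm_num) (by norm_num))
      (hp (1/2) (by norm_num) (by norm_num))
    rw [AffineMap.lineMap_apply_module'] at h
    rw [SetLike.mem_coe]
    convert! h using 1
    module
  have h1 := Metric.infDist_le_dist_of_mem (x := x) hfoot
  have hcr : cross (a - x) (b - x) = - cross w e := by
    simp only [cross, hw, he, PiLp.sub_apply]; ring
  rw [hcr, abs_neg, hd]
  refine (mul_le_mul_of_nonneg_left h1 (norm_nonneg _)).trans ?_
  apply le_of_sq_le_sq _ (abs_nonneg _)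
  rw [sq_abs, mul_pow, dist_eq_norm, show x - (a + c • e) = w - c • e by rw [hw]; abel,
    norm_sub_sq_real w, norm_smul, inner_smul_right, mul_pow, Real.norm_eq_abs, sq_abs]
  have h2 := cross_sq_add_inner_sq w e
  have hc : c * ‖e‖ ^ 2 = inner ℝ w e := by simp only [c]; field_simp
  apply le_of_eq
  linear_combination (-1) * h2 + (c * ‖e‖ ^ 2 - inner ℝ w e) * hc

/-! ### The relative isoperimetric inequality in polygonal domains -/

/-- `P` bounds the perimeter of `S` inside `Ω`: the set of points that leave `S` under the
translation by `z`, along a segment contained in `Ω`, has area at most `‖z‖ P`. This weak form of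
the perimeter is all the isoperimetric argument needs, and it is easy to verify for unions of
cells of a mesh. -/
structure HasPerimeterBound (Ω S : Set Plane) (P : ℝ) : Prop where
  measurableSet : MeasurableSet S
  nonneg : 0 ≤ P
  volume_le : ∀ z : Plane, volume {x | segment ℝ x (x + z) ⊆ Ω ∧ x ∈ S ∧ x + z ∉ S} ≤
    ENNReal.ofReal (‖z‖ * P)

lemma HasPerimeterBound.compl {Ω S : Set Plane} {P : ℝ} (h : HasPerimeterBound Ω S P) :
    HasPerimeterBound Ω Sᶜ P := by
  refine ⟨h.measurableSet.compl, h.nonneg, fun z => ?_⟩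
  have h1 := h.volume_le (-z)
  rw [norm_neg, ← measure_preimage_add_right volume z] at h1
  refine (measure_mono ?_).trans h1
  rintro x ⟨h2, h3, h4⟩
  refine ⟨?_, by simpa using h4, by simpa using h3⟩
  rw [segment_symm]
  simpa using h2

/-- The scaling argument behind the isoperimetric inequality in a convex set: contracting `U`
towards its points by the factor `1 - t`, with `t ^ 2 = 2 |U ∩ S| / |U|`, moves at least half of
`U ∩ S` out of `S` on average, while the perimeter bounds the moved mass by a multiple of `t`. -/
lemma volume_inter_le_of_le_half {Ω U S : Set Plane} {P D : ℝ} (hP : HasPerimeterBound Ω S P)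
    (hU : IsOpen U) (hc : Convex ℝ U) (hsub : U ⊆ Ω) (hD : ∀ x ∈ U, ∀ y ∈ U, dist x y ≤ D)
    (hD0 : 0 ≤ D) (hfin : volume U ≠ ⊤) (hpos : 0 < volume.real U)
    (hhalf : volume.real (U ∩ S) ≤ volume.real U / 2) :
    volume.real (U ∩ S) ≤
      8 * (D * volume.real (Metric.closedBall (0 : Plane) D)) ^ 2 / volume.real U ^ 3 * P ^ 2 := by
  set u := volume.real U
  set a := volume.real (U ∩ S) with ha
  set β := volume.real (Metric.closedBall (0 : Plane) D) with hβ
  have hP0 := hP.nonneg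
  rcases (measureReal_nonneg : 0 ≤ a).eq_or_lt with h0 | ha0
  · change a ≤ _
    rw [ha, ← h0]; positivity
  have hUS : volume (U ∩ S) ≠ ⊤ := measure_ne_top_of_subset Set.inter_subset_left hfin
  have hAm : MeasurableSet (U ∩ S) := hU.measurableSet.inter hP.measurableSet
  set t := Real.sqrt (2 * a / u) with ht
  have ht0 : 0 < t := Real.sqrt_pos.2 (by positivity)
  have htsq : t ^ 2 = 2 * a / u := Real.sq_sqrt (by positivity)
  have ht1 : t ≤ 1 := by
    rw [ht, Real.sqrt_le_one, div_le_one hpos]; linarith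
  let E : Set Plane → Set (Plane × Plane) := fun T =>
    {p | (p.1 ∈ U ∧ p.1 ∈ S) ∧ p.2 ∈ U ∧ p.1 + t • (p.2 - p.1) ∈ T}
  have hEm : ∀ T, MeasurableSet T → MeasurableSet (E T) := by
    intro T hT
    have h1 : Measurable fun p : Plane × Plane => p.1 + t • (p.2 - p.1) := by fun_prop
    exact (measurable_fst hAm).inter ((measurable_snd hU.measurableSet).inter (h1 hT))
  have hconv : ∀ x ∈ U, ∀ y ∈ U, segment ℝ x (x + t • (y - x)) ⊆ U := by
    intro x hx y hy
    apply hc.segment_subset hx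
    have := hc hx hy (by linarith : 0 ≤ 1 - t) ht0.le (by ring)
    convert! this using 1
    module
  -- the mass that stays in `S`
  have hE2 : volume (E (U ∩ S)) ≤ ENNReal.ofReal (a * u / 2) := by
    have hs : ∀ x, volume (Prod.mk x ⁻¹' E (U ∩ S)) ≤
        (U ∩ S).indicator (fun _ => ENNReal.ofReal (u / 2)) x := by
      intro x
      by_cases hx : x ∈ U ∩ S
      · rw [Set.indicator_of_mem hx]
        have h1 : Prod.mk x ⁻¹' E (U ∩ S) ⊆
            (fun y => y + -x) ⁻¹' ((fun y => t • y) ⁻¹' ((fun y => x + y) ⁻¹' (U ∩ S))) := by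
          rintro y ⟨-, -, h⟩
          simpa [sub_eq_add_neg] using h
        refine (measure_mono h1).trans ?_
        rw [measure_preimage_add_right, Measure.addHaar_preimage_smul _ ht0.ne',
          measure_preimage_add, ← ENNReal.ofReal_toReal hUS, ← ENNReal.ofReal_mul (by positivity)]
        apply ENNReal.ofReal_le_ofReal
        change _ * a ≤ _
        simp only [finrank_euclideanSpace, Fintype.card_fin]
        rw [htsq, abs_of_nonneg (by positivity)]
        apply le_of_eq
        have : a ≠ 0 := ha0.ne'
        field_simp
      · have : Prod.mk x ⁻¹' E (U ∩ S) = ∅ := by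
          ext y
          simp only [Set.mem_preimage, Set.mem_empty_iff_false, iff_false]
          exact fun h => hx h.1
        rw [this]; simp
    calc volume (E (U ∩ S)) = ∫⁻ x, volume (Prod.mk x ⁻¹' E (U ∩ S)) :=
          Measure.prod_apply (hEm _ hAm)
      _ ≤ ∫⁻ x, (U ∩ S).indicator (fun _ => ENNReal.ofReal (u / 2)) x := lintegral_mono hs
      _ = ENNReal.ofReal (u / 2) * volume (U ∩ S) := by
          rw [lintegral_indicator hAm, setLIntegral_const]
      _ = ENNReal.ofReal (a * u / 2) := by
          rw [← ENNReal.ofReal_toReal hUS, ← ENNReal.ofReal_mul (by positivity)]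
          congr 1
          change _ * a = _
          ring
  -- the mass that leaves `S`
  have hE1 : volume (E Sᶜ) ≤ ENNReal.ofReal (t * D * P * β) := by
    have hmp := measurePreserving_prod_add (volume : Measure Plane) (volume : Measure Plane)
    have hEm' := hEm _ hP.measurableSet.compl
    have hs : ∀ z : Plane, volume ((fun x => (x, z)) ⁻¹'
          ((fun p : Plane × Plane => (p.1, p.1 + p.2)) ⁻¹' E Sᶜ)) ≤
        (Metric.closedBall (0 : Plane) D).indicator (fun _ => ENNReal.ofReal (t * D * P)) z := by
      intro z
      by_cases hz : z ∈ Metric.closedBall (0 : Plane) D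
      · rw [Set.indicator_of_mem hz]
        refine (measure_mono ?_).trans ((hP.volume_le (t • z)).trans
          (ENNReal.ofReal_le_ofReal ?_))
        · rintro x ⟨⟨h1, h2⟩, h3, h4⟩
          have h5 := hconv x h1 _ h3
          simp only [add_sub_cancel_left] at h5 h4
          exact ⟨h5.trans hsub, h2, h4⟩
        · rw [norm_smul, Real.norm_eq_abs, abs_of_pos ht0]
          have : ‖z‖ ≤ D := by simpa using hz
          gcongr
      · have : ((fun x => (x, z)) ⁻¹'
            ((fun p : Plane × Plane => (p.1, p.1 + p.2)) ⁻¹' E Sᶜ)) = ∅ := by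
          ext x
          simp only [Set.mem_preimage, Set.mem_empty_iff_false, iff_false]
          rintro ⟨⟨h1, -⟩, h2, -⟩
          apply hz
          have := hD _ h2 _ h1
          simpa [dist_eq_norm] using this
        rw [this]; simp
    calc volume (E Sᶜ) = volume ((fun p : Plane × Plane => (p.1, p.1 + p.2)) ⁻¹' E Sᶜ) :=
          (hmp.measure_preimage hEm'.nullMeasurableSet).symm
      _ = ∫⁻ z, volume ((fun x => (x, z)) ⁻¹'
          ((fun p : Plane × Plane => (p.1, p.1 + p.2)) ⁻¹' E Sᶜ)) :=
          Measure.prod_apply_symm (hmp.measurable hEm')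
      _ ≤ ∫⁻ z, (Metric.closedBall (0 : Plane) D).indicator
            (fun _ => ENNReal.ofReal (t * D * P)) z := lintegral_mono hs
      _ = ENNReal.ofReal (t * D * P) * volume (Metric.closedBall (0 : Plane) D) := by
          rw [lintegral_indicator measurableSet_closedBall, setLIntegral_const]
      _ = ENNReal.ofReal (t * D * P * β) := by
          rw [← ENNReal.ofReal_toReal (measure_closedBall_lt_top (μ := volume)
            (x := (0 : Plane)) (r := D)).ne, ← ENNReal.ofReal_mul (by positivity)]
          rfl
  have hsplit : (U ∩ S) ×ˢ U ⊆ E Sᶜ ∪ E (U ∩ S) := by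
    rintro ⟨x, y⟩ ⟨hx, hy⟩
    by_cases h : x + t • (y - x) ∈ S
    · exact Or.inr ⟨hx, hy, hconv x hx.1 y hy (right_mem_segment ℝ _ _), h⟩
    · exact Or.inl ⟨hx, hy, h⟩
  have hmain : a * u ≤ t * D * P * β + a * u / 2 := by
    have h1 : (volume : Measure (Plane × Plane)) ((U ∩ S) ×ˢ U) = ENNReal.ofReal (a * u) := by
      rw [Measure.volume_eq_prod, Measure.prod_prod, ENNReal.ofReal_mul ha0.le]
      simp only [u, Measure.real, ENNReal.ofReal_toReal hUS, ENNReal.ofReal_toReal hfin]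
    have h2 := (measure_mono hsplit).trans (measure_union_le _ _) |>.trans (add_le_add hE1 hE2)
    rw [h1, ← ENNReal.ofReal_add (by positivity) (by positivity)] at h2
    exact (ENNReal.ofReal_le_ofReal_iff (by positivity)).1 h2
  have h3 : (a * u / 2) ^ 2 ≤ (t * D * P * β) ^ 2 :=
    pow_le_pow_left₀ (by positivity) (by linarith) 2
  have h4 : (t * D * P * β) ^ 2 = 2 * a / u * (D * β) ^ 2 * P ^ 2 := by
    rw [← htsq]; ring
  rw [h4] at h3
  have h5 : a * (a * u ^ 3) ≤ a * (8 * (D * β) ^ 2 * P ^ 2) := by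
    have := mul_le_mul_of_nonneg_right h3 (by positivity : 0 ≤ 4 * u)
    have e : 2 * a / u * (D * β) ^ 2 * P ^ 2 * (4 * u) = a * (8 * (D * β) ^ 2 * P ^ 2) := by
      field_simp; ring
    rw [e] at this
    nlinarith
  have h6 := le_of_mul_le_mul_left h5 ha0
  rw [div_mul_eq_mul_div, le_div_iff₀ (by positivity)]
  exact h6

/-- An isoperimetric coupling of two parts `U`, `V` of `Ω`: a set of small perimeter in `Ω` cannot
occupy much of `U` and miss much of `V`. -/
def IsoperimetricPair (Ω U V : Set Plane) : Prop :=
  ∃ C : ℝ, 0 ≤ C ∧ ∀ S P, HasPerimeterBound Ω S P →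
    min (volume.real (U ∩ S)) (volume.real (V \ S)) ≤ C * P ^ 2

lemma isoperimetricPair_self {Ω U : Set Plane} (hU : IsOpen U) (hc : Convex ℝ U)
    (hb : Bornology.IsBounded U) (hsub : U ⊆ Ω) : IsoperimetricPair Ω U U := by
  rcases U.eq_empty_or_nonempty with rfl | hne
  · exact ⟨0, le_rfl, fun S P _ => by simp⟩
  obtain ⟨D, hD⟩ := Metric.isBounded_iff.1 hb
  have hD0 : 0 ≤ D := by
    obtain ⟨x, hx⟩ := hne
    simpa using hD hx hx
  have hfin : volume U ≠ ⊤ := hb.measure_lt_top.ne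
  have hpos : 0 < volume.real U :=
    ENNReal.toReal_pos (hU.measure_pos volume hne).ne' hfin
  refine ⟨8 * (D * volume.real (Metric.closedBall (0 : Plane) D)) ^ 2 / volume.real U ^ 3,
    by positivity, fun S P hP => ?_⟩
  have hsum : volume.real (U ∩ S) + volume.real (U \ S) = volume.real U :=
    measureReal_inter_add_sdiff hP.measurableSet hfin
  rcases le_total (volume.real (U ∩ S)) (volume.real U / 2) with h | h
  · exact (min_le_left _ _).trans (volume_inter_le_of_le_half hP hU hc hsub
      (fun x hx y hy => hD hx hy) hD0 hfin hpos h)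
  · refine (min_le_right _ _).trans ?_
    rw [Set.sdiff_eq]
    apply volume_inter_le_of_le_half hP.compl hU hc hsub (fun x hx y hy => hD hx hy) hD0 hfin hpos
    rw [← Set.sdiff_eq]
    linarith

namespace IsoperimetricPair

variable {Ω U V W : Set Plane}

lemma symm (h : IsoperimetricPair Ω U V) : IsoperimetricPair Ω V U := by
  obtain ⟨C, hC, h⟩ := h
  refine ⟨C, hC, fun S P hP => ?_⟩
  have := h _ _ hP.compl
  rwa [min_comm, ← Set.sdiff_eq, Set.sdiff_compl] at this

lemma mono {U' V' : Set Plane} (h : IsoperimetricPair Ω U V) (hU : U' ⊆ U) (hV : V' ⊆ V)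
    (hUf : volume U ≠ ⊤) (hVf : volume V ≠ ⊤) : IsoperimetricPair Ω U' V' := by
  obtain ⟨C, hC, h⟩ := h
  refine ⟨C, hC, fun S P hP => le_trans (min_le_min ?_ ?_) (h S P hP)⟩
  · exact measureReal_mono (Set.inter_subset_inter_left _ hU)
      (measure_ne_top_of_subset Set.inter_subset_left hUf)
  · exact measureReal_mono (Set.sdiff_subset_sdiff_left hV)
      (measure_ne_top_of_subset Set.sdiff_subset hVf)

lemma trans (h : IsoperimetricPair Ω U V) (h' : IsoperimetricPair Ω V W)
    (hV : 0 < volume.real V) (hVf : volume V ≠ ⊤) (hWf : volume W ≠ ⊤) :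
    IsoperimetricPair Ω U W := by
  obtain ⟨C, hC, h⟩ := h
  obtain ⟨C', hC', h'⟩ := h'
  refine ⟨C + C' + volume.real W * (2 * (C + C') / volume.real V), by positivity,
    fun S P hP => ?_⟩
  have hsum : volume.real (V ∩ S) + volume.real (V \ S) = volume.real V :=
    measureReal_inter_add_sdiff hP.measurableSet hVf
  have hq : 0 ≤ volume.real W * (2 * (C + C') / volume.real V) * P ^ 2 := by positivity
  have hCP : 0 ≤ C * P ^ 2 := by positivity
  have hCP' : 0 ≤ C' * P ^ 2 := by positivity
  have e : (C + C' + volume.real W * (2 * (C + C') / volume.real V)) * P ^ 2 =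
    C * P ^ 2 + C' * P ^ 2 + volume.real W * (2 * (C + C') / volume.real V) * P ^ 2 := by ring
  rw [e]
  rcases min_le_iff.1 (h S P hP) with h1 | h1
  · exact (min_le_left _ _).trans (by linarith)
  rcases min_le_iff.1 (h' S P hP) with h2 | h2
  · -- `V` is exhausted by two small sets, so `P` is bounded below
    refine (min_le_right _ _).trans ?_
    have h3 : volume.real V ≤ (C + C') * P ^ 2 := by linarith
    have h4 : 1 ≤ 2 * (C + C') / volume.real V * P ^ 2 := by
      rw [div_mul_eq_mul_div, le_div_iff₀ hV]; linarith
    have h5 : volume.real (W \ S) ≤ volume.real W := measureReal_mono Set.sdiff_subset hWf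
    have h6 := mul_le_mul_of_nonneg_left h4 (measureReal_nonneg : 0 ≤ volume.real W)
    rw [mul_one] at h6
    have h7 : volume.real W * (2 * (C + C') / volume.real V) * P ^ 2 =
      volume.real W * (2 * (C + C') / volume.real V * P ^ 2) := by ring
    linarith
  · exact (min_le_right _ _).trans (by linarith)

lemma biUnion_right {ι : Type*} (s : Finset ι) {V : ι → Set Plane}
    (h : ∀ i ∈ s, IsoperimetricPair Ω U (V i)) : IsoperimetricPair Ω U (⋃ i ∈ s, V i) := by
  classical
  induction s using Finset.induction_on with
  | empty => exact ⟨0, le_rfl, fun S P _ => by simp⟩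
  | insert i s hi ih =>
    obtain ⟨C, hC, h1⟩ := h i (Finset.mem_insert_self i s)
    obtain ⟨C', hC', h2⟩ := ih fun j hj => h j (Finset.mem_insert_of_mem hj)
    refine ⟨C + C', by positivity, fun S P hP => ?_⟩
    have h3 : volume.real ((⋃ j ∈ insert i s, V j) \ S) ≤
        volume.real (V i \ S) + volume.real ((⋃ j ∈ s, V j) \ S) := by
      rw [Finset.set_biUnion_insert, Set.union_sdiff_distrib]
      exact measureReal_union_le _ _
    have h4 := h1 S P hP
    have h5 := h2 S P hP
    rw [add_mul]
    refine le_trans ?_ (add_le_add h4 h5)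
    have k1 : 0 ≤ volume.real (U ∩ S) := measureReal_nonneg
    have k2 : 0 ≤ volume.real (V i \ S) := measureReal_nonneg
    have k3 : 0 ≤ volume.real ((⋃ j ∈ s, V j) \ S) := measureReal_nonneg
    rcases le_total (volume.real (U ∩ S)) (volume.real (V i \ S)) with l | l
    · rw [min_eq_left l]
      exact (min_le_left _ _).trans (le_add_of_nonneg_right (le_min k1 k3))
    · rw [min_eq_right l]
      rcases le_total (volume.real (U ∩ S)) (volume.real ((⋃ j ∈ s, V j) \ S)) with l' | l'
      · rw [min_eq_left l']
        exact (min_le_left _ _).trans (by linarith)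
      · rw [min_eq_right l']
        exact (min_le_right _ _).trans h3

lemma of_null_diff {V' : Set Plane} (h : IsoperimetricPair Ω U V) (hVf : volume V ≠ ⊤)
    (hV : volume (V' \ V) = 0) : IsoperimetricPair Ω U V' := by
  obtain ⟨C, hC, h⟩ := h
  refine ⟨C, hC, fun S P hP => le_trans (min_le_min le_rfl ?_) (h S P hP)⟩
  refine ENNReal.toReal_mono (measure_ne_top_of_subset Set.sdiff_subset hVf) ?_
  have hsub : V' \ S ⊆ (V \ S) ∪ (V' \ V) := by
    rintro x ⟨hx, hxS⟩
    by_cases hxV : x ∈ V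
    · exact Or.inl ⟨hxV, hxS⟩
    · exact Or.inr ⟨hx, hxV⟩
  refine (measure_mono hsub).trans ((measure_union_le _ _).trans ?_)
  rw [hV, add_zero]

end IsoperimetricPair

/-- In a connected domain, chains of overlapping balls couple any two convex parts. -/
lemma isoperimetricPair_of_isConnected {Ω U V : Set Plane} (hΩ : IsOpen Ω) (hcon : IsConnected Ω)
    (hU : IsOpen U) (hUc : Convex ℝ U) (hUb : Bornology.IsBounded U) (hUΩ : U ⊆ Ω)
    (hV : IsOpen V) (hVc : Convex ℝ V) (hVb : Bornology.IsBounded V) (hVΩ : V ⊆ Ω) :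
    IsoperimetricPair Ω U V := by
  let R : Plane → Plane → Prop := fun x y => ∀ U V : Set Plane,
    IsOpen U → Convex ℝ U → Bornology.IsBounded U → U ⊆ Ω → x ∈ U →
    IsOpen V → Convex ℝ V → Bornology.IsBounded V → V ⊆ Ω → y ∈ V → IsoperimetricPair Ω U V
  have real_pos : ∀ {W : Set Plane}, IsOpen W → Bornology.IsBounded W → W.Nonempty →
      0 < volume.real W := fun hW hb hne =>
    ENNReal.toReal_pos (hW.measure_pos volume hne).ne' hb.measure_lt_top.ne
  have hR : ∀ x ∈ Ω, ∀ y ∈ Ω, R x y := by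
    intro x hx y hy
    refine hcon.isPreconnected.induction₂ R ?_ ?_ ?_ hx hy
    · intro x hx
      obtain ⟨ε, hε, hB⟩ := Metric.isOpen_iff.1 hΩ x hx
      refine mem_nhdsWithin_of_mem_nhds (Filter.mem_of_superset (Metric.ball_mem_nhds x hε) ?_)
      intro y hy U V hU hUc hUb hUΩ hxU hV hVc hVb hVΩ hyV
      have hBb : Bornology.IsBounded (Metric.ball x ε) := Metric.isBounded_ball
      have h1 : IsoperimetricPair Ω U (U ∩ Metric.ball x ε) :=
        (isoperimetricPair_self hU hUc hUb hUΩ).mono subset_rfl Set.inter_subset_left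
          hUb.measure_lt_top.ne hUb.measure_lt_top.ne
      have h2 : IsoperimetricPair Ω (U ∩ Metric.ball x ε) (V ∩ Metric.ball x ε) :=
        (isoperimetricPair_self Metric.isOpen_ball (convex_ball x ε) hBb hB).mono
          Set.inter_subset_right Set.inter_subset_right
          hBb.measure_lt_top.ne hBb.measure_lt_top.ne
      have h3 : IsoperimetricPair Ω (V ∩ Metric.ball x ε) V :=
        (isoperimetricPair_self hV hVc hVb hVΩ).mono Set.inter_subset_left subset_rfl
          hVb.measure_lt_top.ne hVb.measure_lt_top.ne
      have b1 := hUb.subset (Set.inter_subset_left : U ∩ Metric.ball x ε ⊆ U)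
      have b2 := hVb.subset (Set.inter_subset_left : V ∩ Metric.ball x ε ⊆ V)
      exact (h1.trans h2
        (real_pos (hU.inter Metric.isOpen_ball) b1 ⟨x, hxU, Metric.mem_ball_self hε⟩)
        b1.measure_lt_top.ne b2.measure_lt_top.ne).trans h3
        (real_pos (hV.inter Metric.isOpen_ball) b2 ⟨y, hyV, hy⟩)
        b2.measure_lt_top.ne hVb.measure_lt_top.ne
    · intro x y z hx hy hz hxy hyz U W hU hUc hUb hUΩ hxU hW hWc hWb hWΩ hzW
      obtain ⟨ε, hε, hB⟩ := Metric.isOpen_iff.1 hΩ y hy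
      have hBb : Bornology.IsBounded (Metric.ball y ε) := Metric.isBounded_ball
      exact (hxy U _ hU hUc hUb hUΩ hxU Metric.isOpen_ball (convex_ball y ε) hBb hB
        (Metric.mem_ball_self hε)).trans (hyz _ W Metric.isOpen_ball (convex_ball y ε) hBb hB
        (Metric.mem_ball_self hε) hW hWc hWb hWΩ hzW)
        (real_pos Metric.isOpen_ball hBb ⟨y, Metric.mem_ball_self hε⟩)
        hBb.measure_lt_top.ne hWb.measure_lt_top.ne
    · intro x y _ _ hxy U V hU hUc hUb hUΩ hxU hV hVc hVb hVΩ hyV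
      exact (hxy V U hV hVc hVb hVΩ hyV hU hUc hUb hUΩ hxU).symm
  rcases U.eq_empty_or_nonempty with rfl | ⟨x, hx⟩
  · exact ⟨0, le_rfl, fun S P _ => by simp⟩
  rcases V.eq_empty_or_nonempty with rfl | ⟨y, hy⟩
  · exact ⟨0, le_rfl, fun S P _ => by simp⟩
  exact hR x (hUΩ hx) y (hVΩ hy) U V hU hUc hUb hUΩ hx hV hVc hVb hVΩ hy

/-- Every segment lies on a line, given by the vanishing of a nonzero affine function. -/
lemma exists_line_through_segment (a b : Plane) : ∃ n : Plane, n ≠ 0 ∧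
    ∀ x ∈ segment ℝ a b, inner ℝ n (x - a) = 0 := by
  obtain ⟨n, hn, h⟩ : ∃ n : Plane, n ≠ 0 ∧ inner ℝ n (b - a) = 0 := by
    by_cases hab : b - a = 0
    · refine ⟨EuclideanSpace.single 0 1, by simp, by simp [hab]⟩
    · refine ⟨WithLp.toLp 2 ![-(b - a) 1, (b - a) 0], ?_, ?_⟩
      · intro h
        apply hab
        have h0 := congrArg (fun v : Plane => v 0) h
        have h1 := congrArg (fun v : Plane => v 1) h
        ext i; fin_cases i
        · simpa using h1
        · simp at h0; simp; linarith
      · rw [inner_eq]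
        simp; ring
  refine ⟨n, hn, fun x hx => ?_⟩
  rw [segment_eq_image'] at hx
  obtain ⟨s, -, rfl⟩ := hx
  simp only [add_sub_cancel_left]
  rw [inner_smul_right, h, mul_zero]

lemma volume_line_eq_zero {n : Plane} (hn : n ≠ 0) (a : Plane) :
    volume {x : Plane | inner ℝ n (x - a) = 0} = 0 := by
  have h := Measure.addHaar_submodule volume (LinearMap.ker (innerₛₗ ℝ n)) (by
    intro h
    apply hn
    have : n ∈ LinearMap.ker (innerₛₗ ℝ n) := h ▸ Submodule.mem_top
    simpa using this)
  rw [← measure_preimage_add_right volume (-a)] at h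
  convert! h using 2

/-- The relative isoperimetric inequality in a polygonal domain. The lines carrying the boundary
segments cut the plane into convex cells; those that meet `Ω` are contained in `Ω`, and they
exhaust it up to a null set. -/
theorem IsPolygonalDomain.isoperimetricPair {Ω : Set Plane} (hΩ : IsPolygonalDomain Ω) :
    IsoperimetricPair Ω Ω Ω := by
  classical
  obtain ⟨s, hs⟩ := hΩ.frontier_eq
  choose n hn0 hn using fun p : Plane × Plane => exists_line_through_segment p.1 p.2
  let ℓ : Plane × Plane → Plane → ℝ := fun p x => inner ℝ (n p) (x - p.1)
  -- `piece T` is the cell where the affine functions in `T` are positive, the others negative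
  let piece : Finset (Plane × Plane) → Set Plane := fun T =>
    {x | x ∈ Ω ∧ ∀ p ∈ s, if p ∈ T then 0 < ℓ p x else ℓ p x < 0}
  have hℓ : ∀ p, Continuous (ℓ p) := fun p => by fun_prop
  have hcell : ∀ T : Finset (Plane × Plane),
      IsOpen {x | ∀ p ∈ s, if p ∈ T then 0 < ℓ p x else ℓ p x < 0} ∧
      Convex ℝ {x | ∀ p ∈ s, if p ∈ T then 0 < ℓ p x else ℓ p x < 0} := by
    intro T
    have e : {x | ∀ p ∈ s, if p ∈ T then 0 < ℓ p x else ℓ p x < 0} =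
        ⋂ p ∈ s, {x | if p ∈ T then 0 < ℓ p x else ℓ p x < 0} := by
      ext x; simp
    rw [e]
    have hlin : ∀ p x, ℓ p x = innerₛₗ ℝ (n p) x - inner ℝ (n p) p.1 := fun p x => by
      simp [ℓ, inner_sub_right]
    constructor
    · refine isOpen_biInter_finset fun p _ => ?_
      split_ifs
      · exact isOpen_lt continuous_const (hℓ p)
      · exact isOpen_lt (hℓ p) continuous_const
    · refine convex_iInter₂ fun p _ => ?_
      split_ifs
      · simp only [hlin, sub_pos]
        exact convex_halfSpace_gt (innerₛₗ ℝ (n p)).isLinear _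
      · simp only [hlin, sub_neg]
        exact convex_halfSpace_lt (innerₛₗ ℝ (n p)).isLinear _
  have hpiece : ∀ T, IsOpen (piece T) ∧ Convex ℝ (piece T) := by
    intro T
    refine ⟨hΩ.isOpen.inter (hcell T).1, ?_⟩
    rcases (piece T).eq_empty_or_nonempty with h | ⟨x, hxΩ, hx⟩
    · rw [h]; exact convex_empty
    · have hsub : {x | ∀ p ∈ s, if p ∈ T then 0 < ℓ p x else ℓ p x < 0} ⊆ Ω := by
        refine (hcell T).2.isPreconnected.subset_left_of_subset_union hΩ.isOpen
          (isClosed_closure (s := Ω)).isOpen_compl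
          (Set.disjoint_compl_right_iff_subset.2 subset_closure) ?_ ⟨x, hx, hxΩ⟩
        intro z hz
        by_contra hz'
        rw [Set.mem_union, not_or, Set.notMem_compl_iff] at hz'
        have hzf : z ∈ frontier Ω := ⟨hz'.2, by rw [hΩ.isOpen.interior_eq]; exact hz'.1⟩
        rw [hs] at hzf
        obtain ⟨p, hp, hzp⟩ := Set.mem_iUnion₂.1 hzf
        have h0 : ℓ p z = 0 := hn p z hzp
        have h1 := hz p hp
        rw [h0] at h1
        simp at h1
      have e : piece T = {x | ∀ p ∈ s, if p ∈ T then 0 < ℓ p x else ℓ p x < 0} :=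
        Set.inter_eq_right.2 hsub
      rw [e]
      exact (hcell T).2
  have hsub : ∀ T, piece T ⊆ Ω := fun T x hx => hx.1
  have hbd : ∀ T, Bornology.IsBounded (piece T) := fun T => hΩ.isBounded.subset (hsub T)
  have hfin : volume (⋃ T ∈ s.powerset, piece T) ≠ ⊤ :=
    measure_ne_top_of_subset (Set.iUnion₂_subset fun T _ => hsub T) hΩ.isBounded.measure_lt_top.ne
  have hnull : volume (Ω \ ⋃ T ∈ s.powerset, piece T) = 0 := by
    refine measure_mono_null (t := ⋃ p ∈ s, {x | ℓ p x = 0}) ?_ ?_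
    · rintro x ⟨hxΩ, hx⟩
      by_contra hx'
      apply hx
      simp only [Set.mem_iUnion, not_exists] at hx'
      refine Set.mem_iUnion₂.2 ⟨s.filter fun p => 0 < ℓ p x, by simp, hxΩ, fun p hp => ?_⟩
      split_ifs with h
      · exact (Finset.mem_filter.1 h).2
      · refine lt_of_le_of_ne ?_ (hx' p hp)
        by_contra h'
        exact h (Finset.mem_filter.2 ⟨hp, not_le.1 h'⟩)
    · exact (measure_biUnion_null_iff s.countable_toSet).2 fun p _ =>
        volume_line_eq_zero (hn0 p) p.1
  have key : ∀ T, IsoperimetricPair Ω Ω (piece T) := by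
    intro T
    refine (IsoperimetricPair.of_null_diff (IsoperimetricPair.biUnion_right _
      fun T' _ => ?_) hfin hnull).symm
    exact isoperimetricPair_of_isConnected hΩ.isOpen hΩ.isConnected (hpiece T).1 (hpiece T).2
      (hbd T) (hsub T) (hpiece T').1 (hpiece T').2 (hbd T') (hsub T')
  exact IsoperimetricPair.of_null_diff (IsoperimetricPair.biUnion_right _ fun T _ => key T)
    hfin hnull

/-! ### Geometry of admissible meshes -/

namespace AdmissibleMesh

variable {Ω : Set Plane} {ι κ : Type} (𝓜 : AdmissibleMesh Ω ι κ)

lemma hausdorffMeasure_edge {σ : κ} {a b : Plane} (h : 𝓜.edge σ = openSegment ℝ a b) :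
    Measure.hausdorffMeasure 1 (𝓜.edge σ) = edist a b := by
  have hna : NullSingletonClass (Measure.hausdorffMeasure 1 : Measure Plane) :=
    Measure.nullSingletonClass_hausdorff Plane one_pos
  rw [h, ← hausdorffMeasure_segment a b, ← insert_endpoints_openSegment]
  refine le_antisymm (measure_mono fun x hx => by simp [hx]) ?_
  have e : insert a (insert b (openSegment ℝ a b)) = ({a, b} : Set Plane) ∪ openSegment ℝ a b := by
    ext; simp [or_assoc]
  rw [e]
  refine (measure_union_le _ _).trans ?_
  rw [(Set.toFinite {a, b}).measure_zero, zero_add]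

lemma length_eq {σ : κ} {a b : Plane} (h : 𝓜.edge σ = openSegment ℝ a b) :
    𝓜.length σ = dist a b := by
  rw [length, Measure.real, 𝓜.hausdorffMeasure_edge h, edist_dist, ENNReal.toReal_ofReal dist_nonneg]

lemma length_pos (σ : κ) : 0 < 𝓜.length σ := by
  obtain ⟨a, b, hab, h⟩ := 𝓜.edge_segment σ
  rw [𝓜.length_eq h]
  exact dist_pos.2 hab

lemma hausdorffMeasure_edge_ne_zero (σ : κ) : Measure.hausdorffMeasure 1 (𝓜.edge σ) ≠ 0 := by
  obtain ⟨a, b, hab, h⟩ := 𝓜.edge_segment σ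
  rw [𝓜.hausdorffMeasure_edge h]
  simpa using hab

lemma interior_cell (K : ι) : interior (𝓜.cell K) = 𝓜.cell K := (𝓜.cell_isOpen K).interior_eq

lemma notMem_cell_of_mem_frontier {K : ι} {p : Plane} (h : p ∈ frontier (𝓜.cell K)) :
    p ∉ 𝓜.cell K := by
  rw [frontier, 𝓜.interior_cell] at h
  exact h.2

/-- Points strictly between a point of the cell and a point of its closure belong to the cell. -/
lemma openSegment_subset_cell {K : ι} {x y : Plane} (hx : x ∈ 𝓜.cell K)
    (hy : y ∈ closure (𝓜.cell K)) : openSegment ℝ x y ⊆ 𝓜.cell K := by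
  have := (𝓜.cell_convex K).openSegment_interior_closure_subset_interior
    (by rwa [𝓜.interior_cell]) hy
  rwa [𝓜.interior_cell] at this

lemma disjoint_cell {K L : ι} (hKL : K ≠ L) : Disjoint (𝓜.cell K) (𝓜.cell L) := by
  rw [Set.disjoint_iff_inter_eq_empty]
  by_contra hne
  obtain ⟨x, hx⟩ := Set.nonempty_iff_ne_empty.2 hne
  have hopen : IsOpen (𝓜.cell K ∩ 𝓜.cell L) := (𝓜.cell_isOpen K).inter (𝓜.cell_isOpen L)
  have hsub : 𝓜.cell K ∩ 𝓜.cell L ⊆ closure (𝓜.cell K) ∩ closure (𝓜.cell L) :=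
    Set.inter_subset_inter subset_closure subset_closure
  rcases 𝓜.inter_closure K L hKL with h | ⟨σ, h⟩
  · obtain ⟨ε, hε, hB⟩ := Metric.isOpen_iff.1 hopen x hx
    let y : Plane := x + EuclideanSpace.single 0 (ε / 2)
    have hy : y ∈ Metric.ball x ε := by
      simp only [y, Metric.mem_ball, dist_self_add_left, PiLp.norm_single,
        Real.norm_eq_abs, abs_of_pos (half_pos hε)]
      linarith
    have h1 : segment ℝ x y ⊆ closure (𝓜.cell K) ∩ closure (𝓜.cell L) :=
      ((convex_ball x ε).segment_subset (Metric.mem_ball_self hε) hy).trans (hB.trans hsub)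
    have h2 := measure_mono_null h1 h
    rw [hausdorffMeasure_segment, edist_eq_zero] at h2
    have : EuclideanSpace.single (0 : Fin 2) (ε / 2) = (0 : Plane) := by
      simpa [y] using h2.symm
    have := congrArg (fun v : Plane => v 0) this
    simp at this
    linarith
  · obtain ⟨a, b, hab, hσ⟩ := 𝓜.edge_segment σ
    rw [h, hσ, closure_openSegment] at hsub
    obtain ⟨n, hn, hl⟩ := exists_line_through_segment a b
    exact (hopen.measure_pos volume ⟨x, hx⟩).ne'
      (measure_mono_null (hsub.trans fun y hy => hl y hy) (volume_line_eq_zero hn a))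

lemma disjoint_cell_closure {K L : ι} (hKL : K ≠ L) :
    Disjoint (𝓜.cell K) (closure (𝓜.cell L)) :=
  (𝓜.disjoint_cell hKL).closure_right (𝓜.cell_isOpen K)

lemma subset_iUnion_closure [Finite ι] : Ω ⊆ ⋃ K, closure (𝓜.cell K) := by
  rw [← closure_iUnion_of_finite, 𝓜.closure_iUnion]
  exact subset_closure

/-- An edge of two distinct cells is their interface. -/
lemma isInterface_of_subset_frontier {K L : ι} {σ : κ} (hKL : K ≠ L)
    (hK : 𝓜.edge σ ⊆ frontier (𝓜.cell K)) (hL : 𝓜.edge σ ⊆ frontier (𝓜.cell L)) :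
    𝓜.IsInterface K L σ := by
  refine ⟨hKL, ?_⟩
  have hsub : 𝓜.edge σ ⊆ closure (𝓜.cell K) ∩ closure (𝓜.cell L) :=
    Set.subset_inter (hK.trans frontier_subset_closure) (hL.trans frontier_subset_closure)
  rcases 𝓜.inter_closure K L hKL with h | ⟨σ', h⟩
  · exact absurd (measure_mono_null hsub h) (𝓜.hausdorffMeasure_edge_ne_zero σ)
  · have : σ = σ' := by
      by_contra hne
      obtain ⟨a, b, hab, hσ⟩ := 𝓜.edge_segment σ'
      have hna : NullSingletonClass (Measure.hausdorffMeasure 1 : Measure Plane) :=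
        Measure.nullSingletonClass_hausdorff Plane one_pos
      refine 𝓜.hausdorffMeasure_edge_ne_zero σ
        (measure_mono_null (t := {a, b}) ?_ ((Set.toFinite {a, b}).measure_zero _))
      intro p hp
      have h1 := hsub hp
      rw [h, hσ, closure_openSegment, ← insert_endpoints_openSegment, ← hσ] at h1
      rcases h1 with h1 | h1 | h1
      · exact Or.inl h1
      · exact Or.inr h1
      · exact absurd h1 (Set.disjoint_left.1 (𝓜.edge_disjoint σ σ' hne) hp)
    rw [this]
    exact h

namespace IsInterface

variable {𝓜} {K L : ι} {σ : κ}

lemma symm (h : 𝓜.IsInterface K L σ) : 𝓜.IsInterface L K σ :=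
  ⟨h.1.symm, by rw [Set.inter_comm]; exact h.2⟩

lemma subset_frontier (h : 𝓜.IsInterface K L σ) : 𝓜.edge σ ⊆ frontier (𝓜.cell K) := by
  intro p hp
  have h1 : p ∈ closure (𝓜.cell K) ∩ closure (𝓜.cell L) := h.2 ▸ subset_closure hp
  refine ⟨h1.1, ?_⟩
  rw [𝓜.interior_cell]
  exact fun h2 => Set.disjoint_left.1 (𝓜.disjoint_cell_closure h.1) h2 h1.2

lemma mem_edges [Fintype κ] (h : 𝓜.IsInterface K L σ) : σ ∈ 𝓜.edges K := by
  simp [edges, h.subset_frontier]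

end IsInterface

lemma subset_frontier_of_mem_edges [Fintype κ] {K : ι} {σ : κ} (h : σ ∈ 𝓜.edges K) :
    𝓜.edge σ ⊆ frontier (𝓜.cell K) := by
  simpa [edges] using h

/-- Apart from the vertices of the mesh, two distinct closed cells only meet in their
interface. -/
lemma exists_isInterface {K L : ι} (hKL : K ≠ L) {p : Plane} (hK : p ∈ closure (𝓜.cell K))
    (hL : p ∈ closure (𝓜.cell L)) (hp : ∀ σ, p ∈ closure (𝓜.edge σ) → p ∈ 𝓜.edge σ) :
    ∃ σ, 𝓜.IsInterface K L σ ∧ p ∈ 𝓜.edge σ := by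
  have fr : ∀ {K L}, K ≠ L → p ∈ closure (𝓜.cell K) → p ∈ closure (𝓜.cell L) →
      ∃ σ, 𝓜.edge σ ⊆ frontier (𝓜.cell K) ∧ p ∈ 𝓜.edge σ := by
    intro K L hKL hK hL
    have h : p ∈ frontier (𝓜.cell K) := by
      refine ⟨hK, ?_⟩
      rw [𝓜.interior_cell]
      exact fun h2 => Set.disjoint_left.1 (𝓜.disjoint_cell_closure hKL) h2 hL
    rw [𝓜.frontier_cell K] at h
    obtain ⟨σ, hσ, hpσ⟩ := Set.mem_iUnion₂.1 h
    exact ⟨σ, hσ, hp σ hpσ⟩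
  obtain ⟨σ, hσ, hpσ⟩ := fr hKL hK hL
  obtain ⟨σ', hσ', hpσ'⟩ := fr hKL.symm hL hK
  have : σ = σ' := by
    by_contra hne
    exact Set.disjoint_left.1 (𝓜.edge_disjoint σ σ' hne) hpσ hpσ'
  subst this
  exact ⟨σ, 𝓜.isInterface_of_subset_frontier hKL hσ hσ', hpσ⟩

/-- The center of a cell is not on the lines that carry its edges. -/
lemma cross_center_ne_zero {K : ι} {σ : κ} {a b : Plane} (hab : a ≠ b)
    (hσ : 𝓜.edge σ = openSegment ℝ a b) (hK : 𝓜.edge σ ⊆ frontier (𝓜.cell K)) :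
    cross (b - a) (𝓜.center K - a) ≠ 0 := by
  intro h
  obtain ⟨β, hβ⟩ := exists_smul_of_cross_eq_zero (sub_ne_zero.2 hab.symm) h
  have hc : 𝓜.center K = a + β • (b - a) := by rw [← hβ]; simp
  have hmem : ∀ s : ℝ, 0 < s → s < 1 → a + s • (b - a) ∈ frontier (𝓜.cell K) := by
    intro s h0 h1
    apply hK
    rw [hσ, openSegment_eq_image']
    exact ⟨s, ⟨h0, h1⟩, rfl⟩
  -- a point of the edge strictly between the center and another point of the edge
  have key : ∀ s t θ : ℝ, 0 < s → s < 1 → 0 < t → t < 1 → 0 < θ → θ < 1 →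
      s = (1 - θ) * β + θ * t → False := by
    intro s t θ hs0 hs1 ht0 ht1 hθ0 hθ1 e
    apply 𝓜.notMem_cell_of_mem_frontier (hmem s hs0 hs1)
    refine 𝓜.openSegment_subset_cell (𝓜.center_mem K) (hmem t ht0 ht1).1
      ⟨1 - θ, θ, by linarith, hθ0, by ring, ?_⟩
    rw [hc, e]
    module
  rcases le_total β (1 / 2) with hβ' | hβ'
  · have h1 : 0 < 4 / 5 - β := by linarith
    refine key (3 / 5) (4 / 5) ((3 / 5 - β) / (4 / 5 - β)) (by norm_num) (by norm_num)
      (by norm_num) (by norm_num) (div_pos (by linarith) h1) ?_ ?_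
    · rw [div_lt_one h1]; linarith
    · linear_combination -div_mul_cancel₀ (3 / 5 - β) h1.ne'
  · have h1 : 0 < β - 1 / 5 := by linarith
    refine key (2 / 5) (1 / 5) ((β - 2 / 5) / (β - 1 / 5)) (by norm_num) (by norm_num)
      (by norm_num) (by norm_num) (div_pos (by linarith) h1) ?_ ?_
    · rw [div_lt_one h1]; linarith
    · linear_combination div_mul_cancel₀ (β - 2 / 5) h1.ne'

/-- Two distinct cells with a common edge have their centers on opposite sides of it. -/
lemma cross_center_mul_neg {K L : ι} (hKL : K ≠ L) {σ : κ} {a b : Plane} (hab : a ≠ b)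
    (hσ : 𝓜.edge σ = openSegment ℝ a b) (hK : 𝓜.edge σ ⊆ frontier (𝓜.cell K))
    (hL : 𝓜.edge σ ⊆ frontier (𝓜.cell L)) :
    cross (b - a) (𝓜.center K - a) * cross (b - a) (𝓜.center L - a) < 0 := by
  have hK0 := 𝓜.cross_center_ne_zero hab hσ hK
  have hL0 := 𝓜.cross_center_ne_zero hab hσ hL
  by_contra hneg
  set cK := cross (b - a) (𝓜.center K - a) with hcK
  set cL := cross (b - a) (𝓜.center L - a) with hcL
  have hpos : 0 < cK * cL := lt_of_le_of_ne (not_lt.1 hneg) (mul_ne_zero hK0 hL0).symm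
  set α := cK / cL
  have hα : 0 < α := div_pos_iff.2 (by rcases mul_pos_iff.1 hpos with h | h <;> tauto)
  set p : Plane := a + (1 / 2 : ℝ) • (b - a) with hp
  have hmem : ∀ s : ℝ, |s| < 1 / 2 → p + s • (b - a) ∈ 𝓜.edge σ := by
    intro s hs
    rw [abs_lt] at hs
    rw [hσ, openSegment_eq_image']
    refine ⟨1 / 2 + s, ⟨by linarith, by linarith⟩, ?_⟩
    simp only [hp]
    module
  obtain ⟨β, hβ⟩ : ∃ β : ℝ, (𝓜.center K - p) - α • (𝓜.center L - p) = β • (b - a) := by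
    apply exists_smul_of_cross_eq_zero (sub_ne_zero.2 hab.symm)
    have e : cK = α * cL := by simp only [α]; field_simp
    rw [hcK, hcL] at e
    simp only [cross, hp, PiLp.sub_apply, PiLp.add_apply, PiLp.smul_apply, smul_eq_mul] at e ⊢
    linear_combination e
  -- close to the midpoint of the edge the two cells overlap
  set s : ℝ := 1 / (8 * (1 + α + |β|)) with hs
  have hs0 : 0 < s := by positivity
  have hsα : s * α ≤ 1 / 8 := by
    rw [hs, one_div_mul_eq_div, div_le_div_iff₀ (by positivity) (by positivity)]
    nlinarith [abs_nonneg β]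
  have hsβ : s * |β| ≤ 1 / 8 := by
    rw [hs, one_div_mul_eq_div, div_le_div_iff₀ (by positivity) (by positivity)]
    nlinarith [abs_nonneg β]
  have hs1 : s < 1 := by
    rw [hs, div_lt_one (by positivity)]
    nlinarith [abs_nonneg β]
  have h0 : p ∈ 𝓜.edge σ := by simpa using hmem 0 (by norm_num)
  have h1 : p + s • (𝓜.center K - p) ∈ 𝓜.cell K := by
    refine 𝓜.openSegment_subset_cell (𝓜.center_mem K) (hK h0).1
      ⟨s, 1 - s, hs0, by linarith, by ring, ?_⟩
    module
  have hsα0 : 0 < s * α := mul_pos hs0 hα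
  have h2 : p + s • (𝓜.center K - p) ∈ 𝓜.cell L := by
    have h3 : p + (s * β / (1 - s * α)) • (b - a) ∈ 𝓜.edge σ := by
      apply hmem
      rw [abs_div, abs_mul, abs_of_pos hs0, abs_of_pos (by linarith : 0 < 1 - s * α),
        div_lt_iff₀ (by linarith)]
      linarith
    refine 𝓜.openSegment_subset_cell (𝓜.center_mem L) (hL h3).1
      ⟨s * α, 1 - s * α, hsα0, by linarith, by ring, ?_⟩
    have e : 𝓜.center K - p = α • (𝓜.center L - p) + β • (b - a) := by rw [← hβ]; abel
    have e2 : (1 - s * α) * (s * β / (1 - s * α)) = s * β :=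
      mul_div_cancel₀ _ (by linarith : 1 - s * α ≠ 0)
    rw [e, smul_add, smul_smul (1 - s * α), e2]
    module
  exact Set.disjoint_left.1 (𝓜.disjoint_cell hKL) h1 h2

lemma IsInterface.unique {𝓜 : AdmissibleMesh Ω ι κ} {K L L' : ι} {σ : κ}
    (h : 𝓜.IsInterface K L σ) (h' : 𝓜.IsInterface K L' σ) : L = L' := by
  by_contra hne
  obtain ⟨a, b, hab, hσ⟩ := 𝓜.edge_segment σ
  have h1 := 𝓜.cross_center_mul_neg h.1 hab hσ h.subset_frontier h.symm.subset_frontier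
  have h2 := 𝓜.cross_center_mul_neg h'.1 hab hσ h'.subset_frontier h'.symm.subset_frontier
  have h3 := 𝓜.cross_center_mul_neg hne hab hσ h.symm.subset_frontier h'.symm.subset_frontier
  have := mul_pos (mul_pos_of_neg_of_neg h1 h2) (neg_pos.2 h3)
  nlinarith [sq_nonneg (cross (b - a) (𝓜.center K - a) * cross (b - a) (𝓜.center L - a) *
    cross (b - a) (𝓜.center L' - a))]

lemma nbr_eq {K L : ι} {σ : κ} (h : 𝓜.IsInterface K L σ) : 𝓜.nbr K σ = L := by
  have hex : ∃ L, 𝓜.IsInterface K L σ := ⟨L, h⟩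
  rw [nbr, dif_pos hex]
  exact hex.choose_spec.unique h

lemma nbr_eq_self {K : ι} {σ : κ} (h : ¬ ∃ L, 𝓜.IsInterface K L σ) : 𝓜.nbr K σ = K := by
  rw [nbr, dif_neg h]

lemma isInterface_nbr {K : ι} {σ : κ} (h : 𝓜.nbr K σ ≠ K) : 𝓜.IsInterface K (𝓜.nbr K σ) σ := by
  by_cases hex : ∃ L, 𝓜.IsInterface K L σ
  · obtain ⟨L, hL⟩ := hex
    rwa [𝓜.nbr_eq hL]
  · exact absurd (𝓜.nbr_eq_self hex) h

@[simp] lemma nbr_nbr (K : ι) (σ : κ) : 𝓜.nbr (𝓜.nbr K σ) σ = K := by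
  by_cases h : 𝓜.nbr K σ = K
  · rw [h, h]
  · exact 𝓜.nbr_eq (𝓜.isInterface_nbr h).symm

lemma mem_edges_nbr [Fintype κ] {K : ι} {σ : κ} (h : σ ∈ 𝓜.edges K) :
    σ ∈ 𝓜.edges (𝓜.nbr K σ) := by
  by_cases h' : 𝓜.nbr K σ = K
  · rwa [h']
  · exact (𝓜.isInterface_nbr h').symm.mem_edges

lemma dSigma_eq {K L : ι} {σ : κ} (h : 𝓜.IsInterface K L σ) :
    𝓜.dSigma K σ = dist (𝓜.center K) (𝓜.center L) := by
  rw [dSigma, if_pos ⟨L, h⟩, 𝓜.nbr_eq h]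

lemma dSigma_nbr (K : ι) (σ : κ) : 𝓜.dSigma (𝓜.nbr K σ) σ = 𝓜.dSigma K σ := by
  by_cases h : 𝓜.nbr K σ = K
  · rw [h]
  · have hi := 𝓜.isInterface_nbr h
    rw [𝓜.dSigma_eq hi, 𝓜.dSigma_eq hi.symm, dist_comm]

lemma trans_nbr (K : ι) (σ : κ) : 𝓜.trans (𝓜.nbr K σ) σ = 𝓜.trans K σ := by
  rw [trans, trans, dSigma_nbr]

lemma dSigma_pos {K : ι} {σ : κ} (h : 𝓜.nbr K σ ≠ K) : 0 < 𝓜.dSigma K σ := by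
  have hi := 𝓜.isInterface_nbr h
  rw [𝓜.dSigma_eq hi, dist_pos]
  intro e
  exact Set.disjoint_left.1 (𝓜.disjoint_cell hi.1) (𝓜.center_mem K) (e ▸ 𝓜.center_mem _)

lemma dSigma_nonneg (K : ι) (σ : κ) : 0 ≤ 𝓜.dSigma K σ := by
  rw [dSigma]
  split_ifs
  · exact dist_nonneg
  · exact Metric.infDist_nonneg

lemma trans_nonneg (K : ι) (σ : κ) : 0 ≤ 𝓜.trans K σ :=
  div_nonneg (𝓜.length_pos σ).le (𝓜.dSigma_nonneg K σ)

lemma trans_pos {K : ι} {σ : κ} (h : 𝓜.nbr K σ ≠ K) : 0 < 𝓜.trans K σ :=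
  div_pos (𝓜.length_pos σ) (𝓜.dSigma_pos h)

/-- Exchanging the roles of the two cells of each interface. -/
lemma sum_edges_swap [Fintype ι] [Fintype κ] (G : ι → κ → ℝ) :
    ∑ K, ∑ σ ∈ 𝓜.edges K, G (𝓜.nbr K σ) σ = ∑ K, ∑ σ ∈ 𝓜.edges K, G K σ := by
  rw [Finset.sum_sigma', Finset.sum_sigma']
  refine Finset.sum_nbij' (fun p => ⟨𝓜.nbr p.1 p.2, p.2⟩) (fun p => ⟨𝓜.nbr p.1 p.2, p.2⟩)
    ?_ ?_ ?_ ?_ ?_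
  · rintro ⟨K, σ⟩ h
    simp only [Finset.mem_sigma, Finset.mem_univ, true_and] at h ⊢
    exact 𝓜.mem_edges_nbr h
  · rintro ⟨K, σ⟩ h
    simp only [Finset.mem_sigma, Finset.mem_univ, true_and] at h ⊢
    exact 𝓜.mem_edges_nbr h
  · rintro ⟨K, σ⟩ h
    simp
  · rintro ⟨K, σ⟩ h
    simp
  · rintro ⟨K, σ⟩ h
    rfl

/-- The total length of the interfaces between the cells in `A` and the other cells. -/
noncomputable def perimeter [Fintype κ] [DecidableEq ι] (A : Finset ι) : ℝ :=
  ∑ K ∈ A, ∑ σ ∈ 𝓜.edges K, if 𝓜.nbr K σ ∈ A then 0 else 𝓜.length σ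

/-- The union of the cells in `A`. -/
def region (A : Finset ι) : Set Plane := ⋃ K ∈ A, 𝓜.cell K

/-- A segment in `Ω` from the region of `A` to its complement that avoids the vertices crosses an
interface between `A` and its complement, because the closed cells cover `Ω` and the segment is
connected. -/
lemma hasPerimeterBound_region [Fintype ι] [Fintype κ] [DecidableEq ι] (A : Finset ι) :
    HasPerimeterBound Ω (𝓜.region A) (𝓜.perimeter A) := by
  have hopen : IsOpen (𝓜.region A) := isOpen_biUnion fun K _ => 𝓜.cell_isOpen K
  refine ⟨hopen.measurableSet, ?_, fun z => ?_⟩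
  · refine Finset.sum_nonneg fun K _ => Finset.sum_nonneg fun σ _ => ?_
    split_ifs
    exacts [le_rfl, (𝓜.length_pos σ).le]
  choose a b hab hσ using 𝓜.edge_segment
  let cr : Plane → Plane → Set Plane := fun p q =>
    {x | (segment ℝ x (x + z) ∩ segment ℝ p q).Nonempty}
  -- exceptional starting points: the end point lies on the boundary of a cell, or the segment
  -- meets a vertex, that is, crosses a degenerate segment
  let N : Set Plane := (⋃ K, (fun x => x + z) ⁻¹' frontier (𝓜.cell K)) ∪
    ⋃ σ, (cr (a σ) (a σ) ∪ cr (b σ) (b σ))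
  have hN : volume N = 0 := by
    refine measure_union_null (measure_iUnion_null fun K => ?_) (measure_iUnion_null fun σ =>
      measure_union_null ?_ ?_)
    · rw [measure_preimage_add_right]
      exact (𝓜.cell_convex K).addHaar_frontier volume
    · simpa [cr] using volume_crossing_le z (a σ) (a σ)
    · simpa [cr] using volume_crossing_le z (b σ) (b σ)
  have hsub : {x | segment ℝ x (x + z) ⊆ Ω ∧ x ∈ 𝓜.region A ∧ x + z ∉ 𝓜.region A} ⊆
      (⋃ K ∈ A, ⋃ σ ∈ 𝓜.edges K, if 𝓜.nbr K σ ∈ A then ∅ else cr (a σ) (b σ)) ∪ N := by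
    rintro x ⟨hxΩ, hxA, hzA⟩
    by_cases hxN : x ∈ N
    · exact Or.inr hxN
    refine Or.inl ?_
    simp only [N, cr, Set.mem_union, Set.mem_iUnion, not_or, not_exists, Set.mem_preimage] at hxN
    obtain ⟨hfr, hvert⟩ := hxN
    obtain ⟨K₀, hK₀, hxK₀⟩ := Set.mem_iUnion₂.1 hxA
    obtain ⟨L₀, hL₀⟩ := Set.mem_iUnion.1 (𝓜.subset_iUnion_closure
      (hxΩ (right_mem_segment ℝ x (x + z))))
    have hL₀' : x + z ∈ 𝓜.cell L₀ := by
      by_contra h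
      exact hfr L₀ ⟨hL₀, by rwa [𝓜.interior_cell]⟩
    have hL₀A : L₀ ∉ A := fun h => hzA (Set.mem_iUnion₂.2 ⟨L₀, h, hL₀'⟩)
    have hconn := isPreconnected_closed_iff.1 (convex_segment (𝕜 := ℝ) x (x + z)).isPreconnected
      (⋃ K ∈ A, closure (𝓜.cell K)) (⋃ K ∈ Aᶜ, closure (𝓜.cell K))
      (isClosed_biUnion_finset fun _ _ => isClosed_closure)
      (isClosed_biUnion_finset fun _ _ => isClosed_closure) ?_
      ⟨x, left_mem_segment ℝ _ _, Set.mem_iUnion₂.2 ⟨K₀, hK₀, subset_closure hxK₀⟩⟩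
      ⟨x + z, right_mem_segment ℝ _ _, Set.mem_iUnion₂.2
        ⟨L₀, Finset.mem_compl.2 hL₀A, hL₀⟩⟩
    · obtain ⟨p, hp, hpA, hpA'⟩ := hconn
      obtain ⟨K, hK, hpK⟩ := Set.mem_iUnion₂.1 hpA
      obtain ⟨L, hL, hpL⟩ := Set.mem_iUnion₂.1 hpA'
      rw [Finset.mem_compl] at hL
      have hKL : K ≠ L := fun h => hL (h ▸ hK)
      obtain ⟨σ, hint, hpσ⟩ := 𝓜.exists_isInterface hKL hpK hpL (by
        intro σ hpσ
        rw [hσ σ, closure_openSegment, ← insert_endpoints_openSegment, ← hσ σ] at hpσ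
        rcases hpσ with rfl | rfl | h
        · exact absurd ⟨_, hp, left_mem_segment ℝ _ _⟩ (hvert σ).1
        · exact absurd ⟨_, hp, left_mem_segment ℝ _ _⟩ (hvert σ).2
        · exact h)
      refine Set.mem_iUnion₂.2 ⟨K, hK, Set.mem_iUnion₂.2 ⟨σ, hint.mem_edges, ?_⟩⟩
      rw [𝓜.nbr_eq hint, if_neg hL]
      refine ⟨p, hp, openSegment_subset_segment ℝ _ _ ?_⟩
      rwa [← hσ σ]
    · intro p hp
      obtain ⟨K, hK⟩ := Set.mem_iUnion.1 (𝓜.subset_iUnion_closure (hxΩ hp))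
      by_cases hKA : K ∈ A
      · exact Or.inl (Set.mem_iUnion₂.2 ⟨K, hKA, hK⟩)
      · exact Or.inr (Set.mem_iUnion₂.2 ⟨K, Finset.mem_compl.2 hKA, hK⟩)
  refine (measure_mono hsub).trans ((measure_union_le _ _).trans ?_)
  rw [hN, add_zero]
  have hnn : ∀ K σ, 0 ≤ ‖z‖ * (if 𝓜.nbr K σ ∈ A then 0 else 𝓜.length σ) := by
    intro K σ
    refine mul_nonneg (norm_nonneg _) ?_
    split_ifs
    exacts [le_rfl, (𝓜.length_pos σ).le]
  rw [perimeter, Finset.mul_sum, ENNReal.ofReal_sum_of_nonneg fun K _ => by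
    rw [Finset.mul_sum]; exact Finset.sum_nonneg fun σ _ => hnn K σ]
  refine (measure_biUnion_finset_le _ _).trans (Finset.sum_le_sum fun K _ => ?_)
  rw [Finset.mul_sum, ENNReal.ofReal_sum_of_nonneg fun σ _ => hnn K σ]
  refine (measure_biUnion_finset_le _ _).trans (Finset.sum_le_sum fun σ _ => ?_)
  split_ifs
  · simp
  · rw [𝓜.length_eq (hσ σ)]
    exact volume_crossing_le z (a σ) (b σ)

/-- The triangles with apex `x_K` over the edges of `K` are disjoint subsets of `K`. -/
lemma sum_length_mul_distEdge_le [Fintype κ] (hb : Bornology.IsBounded Ω) (K : ι) :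
    ∑ σ ∈ 𝓜.edges K, 𝓜.length σ * 𝓜.distEdge K σ ≤
      𝓜.area K / volume.real stdTriangle := by
  choose a b hab hσ using 𝓜.edge_segment
  let T : κ → Set Plane := fun σ => triangle (𝓜.center K) (a σ) (b σ)
  have hc0 : 0 < volume.real stdTriangle :=
    ENNReal.toReal_pos volume_stdTriangle_pos.ne' volume_stdTriangle_lt_top.ne
  have hfin : volume (𝓜.cell K) ≠ ⊤ := (hb.subset (𝓜.cell_subset K)).measure_lt_top.ne
  have hTsub : ∀ σ ∈ 𝓜.edges K, T σ ⊆ 𝓜.cell K := by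
    rintro σ h y ⟨p, hp, hy⟩
    rw [← hσ σ] at hp
    exact 𝓜.openSegment_subset_cell (𝓜.center_mem K)
      (𝓜.subset_frontier_of_mem_edges h hp).1 hy
  have hray : ∀ p ∈ frontier (𝓜.cell K), ∀ q ∈ frontier (𝓜.cell K), ∀ s t : ℝ, 0 < s → s ≤ t →
      s • (p - 𝓜.center K) = t • (q - 𝓜.center K) → p = q := by
    intro p hp q hq s t hs hst e
    have e' : q - 𝓜.center K = (s / t) • (p - 𝓜.center K) := by
      have ht : t ≠ 0 := by linarith
      rw [div_eq_inv_mul, mul_smul, e, smul_smul, inv_mul_cancel₀ ht, one_smul]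
    rcases hst.eq_or_lt with rfl | hlt
    · rw [div_self hs.ne', one_smul] at e'
      exact (sub_left_injective e').symm
    · exfalso
      apply 𝓜.notMem_cell_of_mem_frontier hq
      have h1 : s / t < 1 := by rw [div_lt_one (by linarith)]; exact hlt
      refine 𝓜.openSegment_subset_cell (𝓜.center_mem K) hp.1
        ⟨1 - s / t, s / t, by linarith, div_pos hs (by linarith), by ring, ?_⟩
      rw [← sub_add_cancel q (𝓜.center K), e']
      module
  have hdisj : (𝓜.edges K : Set κ).PairwiseDisjoint T := by
    intro σ hσK σ' hσK' hne
    refine Set.disjoint_left.2 ?_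
    rintro y ⟨p, hp, hy⟩ ⟨q, hq, hy'⟩
    rw [← hσ] at hp hq
    rw [openSegment_eq_image'] at hy hy'
    obtain ⟨s, ⟨hs0, -⟩, rfl⟩ := hy
    obtain ⟨t, ⟨ht0, -⟩, e⟩ := hy'
    have e' : t • (q - 𝓜.center K) = s • (p - 𝓜.center K) := add_left_cancel e
    have hpf := 𝓜.subset_frontier_of_mem_edges hσK hp
    have hqf := 𝓜.subset_frontier_of_mem_edges hσK' hq
    have hpq : p = q := by
      rcases le_total s t with h | h
      · exact hray p hpf q hqf s t hs0 h e'.symm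
      · exact (hray q hqf p hpf t s ht0 h e').symm
    subst hpq
    exact Set.disjoint_left.1 (𝓜.edge_disjoint σ σ' hne) hp hq
  have hvol : volume.real (⋃ σ ∈ 𝓜.edges K, T σ) = ∑ σ ∈ 𝓜.edges K, volume.real (T σ) :=
    measureReal_biUnion_finset₀ (fun σ h σ' h' hne => (hdisj h h' hne).aedisjoint)
      (fun σ _ => nullMeasurableSet_triangle)
      (fun σ h => measure_ne_top_of_subset (hTsub σ h) hfin)
  rw [le_div_iff₀ hc0, Finset.sum_mul]
  refine le_trans (Finset.sum_le_sum fun σ h => ?_) (hvol.symm.le.trans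
    (measureReal_mono (Set.iUnion₂_subset hTsub) hfin))
  have h1 := dist_mul_infDist_le (𝓜.center K) (hab σ)
  rw [Measure.real, Measure.real, volume_triangle, ENNReal.toReal_mul, ENNReal.toReal_ofReal (abs_nonneg _),
    𝓜.length_eq (hσ σ), distEdge, hσ σ]
  exact mul_le_mul_of_nonneg_right h1 ENNReal.toReal_nonneg

/-- Regularity of the mesh bounds the areas of the diamonds around the edges of a cell by the area
of the cell. -/
lemma sum_length_mul_dSigma_le [Fintype κ] (hb : Bornology.IsBounded Ω) {ζ : ℝ} (hζ : 0 < ζ)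
    (hreg : 𝓜.IsRegular ζ) (K : ι) :
    ∑ σ ∈ 𝓜.edges K, 𝓜.length σ * 𝓜.dSigma K σ ≤
      𝓜.area K / (volume.real stdTriangle * ζ) := by
  have h := 𝓜.sum_length_mul_distEdge_le hb K
  rw [← div_div, le_div_iff₀ hζ, Finset.sum_mul]
  refine (Finset.sum_le_sum fun σ hσ => ?_).trans h
  have := mul_le_mul_of_nonneg_left (hreg K σ hσ) (𝓜.length_pos σ).le
  linarith

lemma area_pos (hb : Bornology.IsBounded Ω) (K : ι) : 0 < 𝓜.area K :=
  ENNReal.toReal_pos ((𝓜.cell_isOpen K).measure_pos volume ⟨_, 𝓜.center_mem K⟩).ne'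
    (hb.subset (𝓜.cell_subset K)).measure_lt_top.ne

lemma volume_region (hb : Bornology.IsBounded Ω) (A : Finset ι) :
    volume.real (𝓜.region A) = ∑ K ∈ A, 𝓜.area K :=
  measureReal_biUnion_finset (fun _ _ _ _ h => 𝓜.disjoint_cell h)
    (fun K _ => (𝓜.cell_isOpen K).measurableSet)
    (fun K _ => (hb.subset (𝓜.cell_subset K)).measure_lt_top.ne)

lemma region_subset (A : Finset ι) : 𝓜.region A ⊆ Ω :=
  Set.iUnion₂_subset fun K _ => 𝓜.cell_subset K

/-- The cells cover `Ω` up to their boundaries, which are null sets by convexity. -/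
lemma volume_diff_region_univ [Fintype ι] : volume (Ω \ 𝓜.region Finset.univ) = 0 := by
  refine measure_mono_null (t := ⋃ K, frontier (𝓜.cell K)) ?_
    (measure_iUnion_null fun K => (𝓜.cell_convex K).addHaar_frontier volume)
  rintro x ⟨hx, hx'⟩
  obtain ⟨K, hK⟩ := Set.mem_iUnion.1 (𝓜.subset_iUnion_closure hx)
  refine Set.mem_iUnion.2 ⟨K, hK, fun h => hx' ?_⟩
  rw [𝓜.interior_cell] at h
  exact Set.mem_iUnion₂.2 ⟨K, Finset.mem_univ K, h⟩

lemma region_univ_ae_eq [Fintype ι] : 𝓜.region Finset.univ =ᵐ[volume] Ω :=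
  (𝓜.region_subset _).eventuallyLE.antisymm (ae_le_set.2 𝓜.volume_diff_region_univ)

lemma sum_area [Fintype ι] (hb : Bornology.IsBounded Ω) :
    ∑ K, 𝓜.area K = volume.real Ω := by
  rw [← 𝓜.volume_region hb, Measure.real, measure_congr 𝓜.region_univ_ae_eq, Measure.real]

/-- Isoperimetric inequality for unions of cells. -/
lemma sum_area_le_mul_perimeter_sq [Fintype ι] [Fintype κ] [DecidableEq ι]
    (hb : Bornology.IsBounded Ω) {C : ℝ} (hC : ∀ S P, HasPerimeterBound Ω S P →
      min (volume.real (Ω ∩ S)) (volume.real (Ω \ S)) ≤ C * P ^ 2) (A : Finset ι)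
    (hA : ∑ K ∈ A, 𝓜.area K ≤ (∑ K, 𝓜.area K) / 2) :
    ∑ K ∈ A, 𝓜.area K ≤ C * 𝓜.perimeter A ^ 2 := by
  have hP := 𝓜.hasPerimeterBound_region A
  have h1 := hC _ _ hP
  have h2 : volume.real (Ω ∩ 𝓜.region A) = ∑ K ∈ A, 𝓜.area K := by
    rw [Set.inter_eq_right.2 (𝓜.region_subset A), 𝓜.volume_region hb]
  have h3 : volume.real (Ω ∩ 𝓜.region A) + volume.real (Ω \ 𝓜.region A) = volume.real Ω :=
    measureReal_inter_add_sdiff hP.measurableSet hb.measure_lt_top.ne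
  rw [𝓜.sum_area hb] at hA
  rw [min_eq_left (by linarith), h2] at h1
  exact h1

end AdmissibleMesh

/-! ### The discrete Sobolev–Poincaré inequality -/

/-- Weighted Cauchy–Schwarz inequality for finite sums. -/
lemma sum_weighted_mul_sq_le {α : Type*} (s : Finset α) {w : α → ℝ} (hw : ∀ i ∈ s, 0 ≤ w i)
    (f g : α → ℝ) :
    (∑ i ∈ s, w i * (f i * g i)) ^ 2 ≤ (∑ i ∈ s, w i * f i ^ 2) * ∑ i ∈ s, w i * g i ^ 2 := by
  apply Finset.sum_sq_le_sum_mul_sum_of_sq_le_mul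
  · exact fun i hi => mul_nonneg (hw i hi) (sq_nonneg _)
  · exact fun i hi => mul_nonneg (hw i hi) (sq_nonneg _)
  · exact fun i _ => le_of_eq (by ring)

/-- A weighted median of a finite family of reals, chosen among its values. -/
lemma exists_median {ι : Type*} [Fintype ι] [Nonempty ι] (m g : ι → ℝ) (hm : ∀ K, 0 ≤ m K) :
    ∃ K₀, ∑ K with g K₀ < g K, m K ≤ (∑ K, m K) / 2 ∧
      ∑ K with g K < g K₀, m K ≤ (∑ K, m K) / 2 := by
  classical
  have hM : 0 ≤ ∑ K, m K := Finset.sum_nonneg fun K _ => hm K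
  -- the smallest value below which lies at least half of the mass
  let T : Finset ι := Finset.univ.filter fun J => (∑ K, m K) / 2 ≤ ∑ K with g K ≤ g J, m K
  have hT : T.Nonempty := by
    obtain ⟨J, -, hJ⟩ := Finset.exists_max_image Finset.univ g Finset.univ_nonempty
    refine ⟨J, Finset.mem_filter.2 ⟨Finset.mem_univ _, ?_⟩⟩
    rw [Finset.filter_true_of_mem fun K _ => hJ K (Finset.mem_univ K)]
    linarith
  obtain ⟨K₀, hK₀, hmin⟩ := Finset.exists_min_image T g hT
  refine ⟨K₀, ?_, ?_⟩
  · have h1 := Finset.sum_filter_add_sum_filter_not Finset.univ (fun K => g K ≤ g K₀) m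
    have h2 := (Finset.mem_filter.1 hK₀).2
    simp only [not_le] at h1
    linarith
  · rcases (Finset.univ.filter fun K => g K < g K₀).eq_empty_or_nonempty with h | h
    · rw [h, Finset.sum_empty]; linarith
    obtain ⟨K₁, hK₁, hmax⟩ := Finset.exists_max_image _ g h
    have hlt := (Finset.mem_filter.1 hK₁).2
    by_contra hgt
    have e : (Finset.univ.filter fun K => g K ≤ g K₁) = Finset.univ.filter fun K => g K < g K₀ := by
      ext K
      simp only [Finset.mem_filter, Finset.mem_univ, true_and]
      exact ⟨fun hK => hK.trans_lt hlt, fun hK => hmax K (by simpa using hK)⟩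
    have := hmin K₁ (Finset.mem_filter.2 ⟨Finset.mem_univ _, by rw [e]; linarith⟩)
    linarith

namespace AdmissibleMesh

variable {Ω : Set Plane} {ι κ : Type} [Fintype ι] [Fintype κ] (𝓜 : AdmissibleMesh Ω ι κ)

/-- The total variation of a piecewise constant function, where each interface is counted from
the side of the larger value only. -/
noncomputable def variation (v : ι → ℝ) : ℝ :=
  ∑ K, ∑ σ ∈ 𝓜.edges K, 𝓜.length σ * max (v K - v (𝓜.nbr K σ)) 0

/-- The discrete Dirichlet energy; each interface is counted twice. -/
noncomputable def energy (g : ι → ℝ) : ℝ :=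
  ∑ K, ∑ σ ∈ 𝓜.edges K, 𝓜.trans K σ * 𝓜.diff g K σ ^ 2

lemma variation_nonneg (v : ι → ℝ) : 0 ≤ 𝓜.variation v :=
  Finset.sum_nonneg fun _ _ => Finset.sum_nonneg fun σ _ =>
    mul_nonneg (𝓜.length_pos σ).le (le_max_right _ _)

lemma energy_nonneg (g : ι → ℝ) : 0 ≤ 𝓜.energy g :=
  Finset.sum_nonneg fun K _ => Finset.sum_nonneg fun σ _ =>
    mul_nonneg (𝓜.trans_nonneg K σ) (sq_nonneg _)

lemma energy_mono {g h : ι → ℝ} (hgh : ∀ K L, |h K - h L| ≤ |g K - g L|) :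
    𝓜.energy h ≤ 𝓜.energy g := by
  refine Finset.sum_le_sum fun K _ => Finset.sum_le_sum fun σ _ =>
    mul_le_mul_of_nonneg_left ?_ (𝓜.trans_nonneg K σ)
  exact sq_le_sq.2 (hgh _ _)

/-- Co-area argument: removing the lowest layer of `v` splits off a multiple of the perimeter of
the support from the variation, and Minkowski's inequality adds up the isoperimetric
inequalities of the layers. -/
lemma sum_area_mul_sq_le_variation [DecidableEq ι] {C : ℝ} (hC : 0 ≤ C)
    (hm : ∀ K, 0 ≤ 𝓜.area K)
    (hiso : ∀ A : Finset ι, ∑ K ∈ A, 𝓜.area K ≤ (∑ K, 𝓜.area K) / 2 →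
      ∑ K ∈ A, 𝓜.area K ≤ C * 𝓜.perimeter A ^ 2) (n : ℕ) :
    ∀ v : ι → ℝ, (∀ K, 0 ≤ v K) → (Finset.univ.filter fun K => v K ≠ 0).card ≤ n →
      ∑ K with v K ≠ 0, 𝓜.area K ≤ (∑ K, 𝓜.area K) / 2 →
      ∑ K, 𝓜.area K * v K ^ 2 ≤ C * 𝓜.variation v ^ 2 := by
  induction n with
  | zero =>
    intro v _ hcard _
    rw [Nat.le_zero, Finset.card_eq_zero, Finset.filter_eq_empty_iff] at hcard
    have h0 : ∀ K, v K = 0 := fun K => not_not.1 (hcard (Finset.mem_univ K))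
    simp only [h0]
    have := 𝓜.variation_nonneg v
    simp only [ne_eq, OfNat.ofNat_ne_zero, not_false_eq_true, zero_pow, mul_zero,
      Finset.sum_const_zero]
    positivity
  | succ n ih =>
    intro v hv hcard hhalf
    set A := Finset.univ.filter fun K => v K ≠ 0 with hA
    have hmemA : ∀ K, K ∈ A ↔ v K ≠ 0 := fun K => by simp [hA]
    rcases A.eq_empty_or_nonempty with hAe | hAne
    · exact ih v hv (by simp [← hA, hAe]) hhalf
    obtain ⟨K₀, hK₀, hmin⟩ := Finset.exists_min_image A v hAne
    set a := v K₀
    have ha : 0 < a := lt_of_le_of_ne (hv K₀) ((hmemA K₀).1 hK₀).symm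
    let v' : ι → ℝ := fun K => if K ∈ A then v K - a else 0
    have hv' : ∀ K, 0 ≤ v' K := fun K => by
      simp only [v']
      split_ifs with h
      · exact sub_nonneg.2 (hmin K h)
      · exact le_rfl
    have hsupp : (Finset.univ.filter fun K => v' K ≠ 0) ⊆ A.erase K₀ := by
      intro K hK
      have hK' := (Finset.mem_filter.1 hK).2
      simp only [v', a] at hK'
      rw [Finset.mem_erase]
      constructor
      · rintro rfl; simp at hK'
      · by_contra h; simp [h] at hK'
    have hcard' : (Finset.univ.filter fun K => v' K ≠ 0).card ≤ n := by
      have h1 := Finset.card_le_card hsupp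
      rw [Finset.card_erase_of_mem hK₀] at h1
      omega
    have hhalf' : ∑ K with v' K ≠ 0, 𝓜.area K ≤ (∑ K, 𝓜.area K) / 2 :=
      (Finset.sum_le_sum_of_subset_of_nonneg (hsupp.trans (Finset.erase_subset _ _))
        fun K _ _ => hm K).trans hhalf
    have hI := ih v' hv' hcard' hhalf'
    have hP := hiso A hhalf
    have hvar : 𝓜.variation v = 𝓜.variation v' + a * 𝓜.perimeter A := by
      have hper : 𝓜.perimeter A = ∑ K, if K ∈ A then
          ∑ σ ∈ 𝓜.edges K, (if 𝓜.nbr K σ ∈ A then 0 else 𝓜.length σ) else 0 := by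
        rw [perimeter, Finset.sum_ite_mem, Finset.univ_inter]
      rw [variation, variation, hper, Finset.mul_sum, ← Finset.sum_add_distrib]
      refine Finset.sum_congr rfl fun K _ => ?_
      by_cases hK : K ∈ A
      · rw [if_pos hK, Finset.mul_sum, ← Finset.sum_add_distrib]
        refine Finset.sum_congr rfl fun σ _ => ?_
        by_cases hL : 𝓜.nbr K σ ∈ A
        · simp [v', hK, hL]
        · have h0 : v (𝓜.nbr K σ) = 0 := not_not.1 fun h => hL ((hmemA _).2 h)
          simp only [v', hK, hL, if_true, if_false, h0, sub_zero]
          rw [max_eq_left (hv K), max_eq_left (sub_nonneg.2 (hmin K hK))]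
          ring
      · have h0 : v K = 0 := not_not.1 fun h => hK ((hmemA _).2 h)
        rw [if_neg hK, mul_zero, add_zero]
        refine Finset.sum_congr rfl fun σ _ => ?_
        rw [max_eq_right (by rw [h0]; linarith [hv (𝓜.nbr K σ)]),
          max_eq_right (by simp only [v', if_neg hK]; linarith [hv' (𝓜.nbr K σ)])]
    have hv'A : ∀ K, v K = v' K + if K ∈ A then a else 0 := by
      intro K
      by_cases hK : K ∈ A
      · simp [v', hK]
      · simpa [v', hK] using not_not.1 fun h => hK ((hmemA _).2 h)
    have hexp : ∑ K, 𝓜.area K * v K ^ 2 = ∑ K, 𝓜.area K * v' K ^ 2 +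
        2 * a * ∑ K ∈ A, 𝓜.area K * (1 * v' K) + a ^ 2 * ∑ K ∈ A, 𝓜.area K := by
      have e : ∀ K, 𝓜.area K * v K ^ 2 = 𝓜.area K * v' K ^ 2 +
          (if K ∈ A then 2 * a * (𝓜.area K * (1 * v' K)) else 0) +
          if K ∈ A then a ^ 2 * 𝓜.area K else 0 := by
        intro K
        rw [hv'A K]
        split_ifs <;> ring
      rw [Finset.sum_congr rfl fun K _ => e K, Finset.sum_add_distrib, Finset.sum_add_distrib,
        Finset.sum_ite_mem, Finset.sum_ite_mem, Finset.univ_inter, Finset.mul_sum, Finset.mul_sum]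
    have hCS := sum_weighted_mul_sq_le A (fun K _ => hm K) (fun _ => 1) v'
    simp only [one_pow, mul_one] at hCS
    have hV := 𝓜.variation_nonneg v'
    have hPn : 0 ≤ 𝓜.perimeter A := Finset.sum_nonneg fun K _ => Finset.sum_nonneg fun σ _ => by
      split_ifs
      exacts [le_rfl, (𝓜.length_pos σ).le]
    have hA' : ∑ K ∈ A, 𝓜.area K * v' K ^ 2 ≤ C * 𝓜.variation v' ^ 2 :=
      (Finset.sum_le_sum_of_subset_of_nonneg (Finset.subset_univ A)
        fun K _ _ => mul_nonneg (hm K) (sq_nonneg _)).trans hI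
    have hcross : ∑ K ∈ A, 𝓜.area K * (1 * v' K) ≤ C * (𝓜.perimeter A * 𝓜.variation v') := by
      apply le_of_sq_le_sq _ (by positivity)
      refine hCS.trans ((mul_le_mul hP hA' (Finset.sum_nonneg fun K _ =>
        mul_nonneg (hm K) (sq_nonneg _)) (by positivity)).trans_eq (by ring))
    rw [hexp, hvar]
    nlinarith [mul_le_mul_of_nonneg_left hcross ha.le,
      mul_le_mul_of_nonneg_left hP (sq_nonneg a)]

/-- The variation of a square is controlled by the energy and the `L²` norm. -/
lemma variation_sq_le (hb : Bornology.IsBounded Ω) {ζ : ℝ} (hζ : 0 < ζ)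
    (hreg : 𝓜.IsRegular ζ) (h : ι → ℝ) :
    𝓜.variation (fun K => h K ^ 2) ^ 2 ≤
      𝓜.energy h * (4 / (volume.real stdTriangle * ζ) * ∑ K, 𝓜.area K * h K ^ 2) := by
  have hle : 𝓜.variation (fun K => h K ^ 2) ≤ ∑ p ∈ Finset.univ.sigma 𝓜.edges,
      𝓜.length p.2 * (|𝓜.diff h p.1 p.2| * |h p.1 + h (𝓜.nbr p.1 p.2)|) := by
    rw [variation, Finset.sum_sigma']
    refine Finset.sum_le_sum fun p _ => mul_le_mul_of_nonneg_left ?_ (𝓜.length_pos _).le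
    rw [← abs_mul, diff]
    refine max_le ?_ (abs_nonneg _)
    refine le_trans (le_of_eq ?_) (neg_le_abs _)
    ring
  have hCS : (∑ p ∈ Finset.univ.sigma 𝓜.edges,
      𝓜.length p.2 * (|𝓜.diff h p.1 p.2| * |h p.1 + h (𝓜.nbr p.1 p.2)|)) ^ 2 ≤
      (∑ p ∈ Finset.univ.sigma 𝓜.edges, 𝓜.trans p.1 p.2 * 𝓜.diff h p.1 p.2 ^ 2) *
      ∑ p ∈ Finset.univ.sigma 𝓜.edges,
        𝓜.length p.2 * 𝓜.dSigma p.1 p.2 * (h p.1 + h (𝓜.nbr p.1 p.2)) ^ 2 := by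
    apply Finset.sum_sq_le_sum_mul_sum_of_sq_le_mul
    · exact fun p _ => mul_nonneg (𝓜.trans_nonneg _ _) (sq_nonneg _)
    · exact fun p _ => mul_nonneg (mul_nonneg (𝓜.length_pos _).le (𝓜.dSigma_nonneg _ _))
        (sq_nonneg _)
    · rintro ⟨K, σ⟩ _
      simp only
      by_cases hn : 𝓜.nbr K σ = K
      · simp [diff, hn]
      · have hd := (𝓜.dSigma_pos hn).ne'
        rw [mul_pow, mul_pow, sq_abs, sq_abs, trans]
        apply le_of_eq
        field_simp
  have hE : ∑ p ∈ Finset.univ.sigma 𝓜.edges, 𝓜.trans p.1 p.2 * 𝓜.diff h p.1 p.2 ^ 2 =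
      𝓜.energy h := by
    rw [energy, Finset.sum_sigma']
  have hL : ∑ p ∈ Finset.univ.sigma 𝓜.edges,
      𝓜.length p.2 * 𝓜.dSigma p.1 p.2 * (h p.1 + h (𝓜.nbr p.1 p.2)) ^ 2 ≤
      4 / (volume.real stdTriangle * ζ) * ∑ K, 𝓜.area K * h K ^ 2 := by
    have h1 : ∑ p ∈ Finset.univ.sigma 𝓜.edges,
        𝓜.length p.2 * 𝓜.dSigma p.1 p.2 * (h p.1 + h (𝓜.nbr p.1 p.2)) ^ 2 ≤
        ∑ K, ∑ σ ∈ 𝓜.edges K, 2 * (𝓜.length σ * 𝓜.dSigma K σ * h K ^ 2) +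
        ∑ K, ∑ σ ∈ 𝓜.edges K, 2 * (𝓜.length σ * 𝓜.dSigma K σ * h (𝓜.nbr K σ) ^ 2) := by
      rw [← Finset.sum_add_distrib, Finset.sum_sigma]
      refine Finset.sum_le_sum fun K _ => ?_
      rw [← Finset.sum_add_distrib]
      refine Finset.sum_le_sum fun σ _ => ?_
      have := mul_nonneg (mul_nonneg (𝓜.length_pos σ).le (𝓜.dSigma_nonneg K σ))
        (sq_nonneg (h K - h (𝓜.nbr K σ)))
      nlinarith
    have h2 : ∑ K, ∑ σ ∈ 𝓜.edges K, 2 * (𝓜.length σ * 𝓜.dSigma K σ * h (𝓜.nbr K σ) ^ 2) =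
        ∑ K, ∑ σ ∈ 𝓜.edges K, 2 * (𝓜.length σ * 𝓜.dSigma K σ * h K ^ 2) := by
      rw [← 𝓜.sum_edges_swap]
      simp only [nbr_nbr, dSigma_nbr]
    rw [h2] at h1
    refine h1.trans ?_
    rw [← Finset.sum_add_distrib, Finset.mul_sum]
    refine Finset.sum_le_sum fun K _ => ?_
    have h3 := mul_le_mul_of_nonneg_right (𝓜.sum_length_mul_dSigma_le hb hζ hreg K)
      (by positivity : 0 ≤ 4 * h K ^ 2)
    rw [Finset.sum_mul] at h3
    rw [← Finset.sum_add_distrib]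
    refine le_trans (le_of_eq (Finset.sum_congr rfl fun σ _ => by ring)) (h3.trans_eq (by ring))
  refine (pow_le_pow_left₀ (𝓜.variation_nonneg _) hle 2).trans (hCS.trans ?_)
  rw [hE]
  exact mul_le_mul_of_nonneg_left hL (𝓜.energy_nonneg h)

/-- Sobolev inequality for nonnegative functions supported in at most half of `Ω`: apply the
isoperimetric inequality in its functional form to the square of the function. -/
lemma sum_area_mul_pow_four_le [DecidableEq ι] (hb : Bornology.IsBounded Ω) {ζ : ℝ} (hζ : 0 < ζ)
    (hreg : 𝓜.IsRegular ζ) {C : ℝ} (hC : 0 ≤ C)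
    (hiso : ∀ A : Finset ι, ∑ K ∈ A, 𝓜.area K ≤ (∑ K, 𝓜.area K) / 2 →
      ∑ K ∈ A, 𝓜.area K ≤ C * 𝓜.perimeter A ^ 2) (h : ι → ℝ)
    (hsupp : ∑ K with h K ≠ 0, 𝓜.area K ≤ (∑ K, 𝓜.area K) / 2) :
    ∑ K, 𝓜.area K * h K ^ 4 ≤
      (4 * C / volume.real stdTriangle) ^ 2 * volume.real Ω / ζ ^ 2 * 𝓜.energy h ^ 2 := by
  have hm : ∀ K, 0 ≤ 𝓜.area K := fun K => (𝓜.area_pos hb K).le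
  set c₀ := volume.real stdTriangle with hc₀
  have hc₀p : 0 < c₀ :=
    ENNReal.toReal_pos volume_stdTriangle_pos.ne' volume_stdTriangle_lt_top.ne
  set H4 := ∑ K, 𝓜.area K * h K ^ 4 with hH4
  set H2 := ∑ K, 𝓜.area K * h K ^ 2 with hH2
  have hE := 𝓜.energy_nonneg h
  have h4 : 0 ≤ H4 := Finset.sum_nonneg fun K _ => mul_nonneg (hm K) (by positivity)
  have h1 : H4 ≤ C * 𝓜.variation (fun K => h K ^ 2) ^ 2 := by
    have := 𝓜.sum_area_mul_sq_le_variation hC hm hiso _ (fun K => h K ^ 2)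
      (fun K => sq_nonneg _) le_rfl (by simpa using hsupp)
    refine le_trans (le_of_eq (Finset.sum_congr rfl fun K _ => by ring)) this
  have h2 : 𝓜.variation (fun K => h K ^ 2) ^ 2 ≤ 𝓜.energy h * (4 / (c₀ * ζ) * H2) :=
    𝓜.variation_sq_le hb hζ hreg h
  have h3 : H2 ^ 2 ≤ volume.real Ω * H4 := by
    have := sum_weighted_mul_sq_le Finset.univ (fun K _ => hm K) (fun _ => 1) (fun K => h K ^ 2)
    simp only [one_pow, mul_one, one_mul, 𝓜.sum_area hb] at this
    refine this.trans (le_of_eq ?_)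
    congr 1
    exact Finset.sum_congr rfl fun K _ => by ring
  have h5 : H4 ≤ 4 * C / c₀ / ζ * 𝓜.energy h * H2 := by
    refine h1.trans ((mul_le_mul_of_nonneg_left h2 hC).trans (le_of_eq ?_))
    field_simp
  have h6 : H4 * H4 ≤ ((4 * C / c₀) ^ 2 * volume.real Ω / ζ ^ 2 * 𝓜.energy h ^ 2) * H4 := by
    have h7 := pow_le_pow_left₀ h4 h5 2
    have h8 := mul_le_mul_of_nonneg_left h3 (sq_nonneg (4 * C / c₀ / ζ * 𝓜.energy h))
    calc H4 * H4 = H4 ^ 2 := by ring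
      _ ≤ (4 * C / c₀ / ζ * 𝓜.energy h * H2) ^ 2 := h7
      _ = (4 * C / c₀ / ζ * 𝓜.energy h) ^ 2 * H2 ^ 2 := by ring
      _ ≤ _ := h8
      _ = _ := by field_simp
  rcases h4.eq_or_lt with h0 | h0
  · rw [← h0]; positivity
  · exact le_of_mul_le_mul_right h6 h0

end AdmissibleMesh

/-- The discrete Sobolev–Poincaré inequality with a constant that depends only on the polygonal
domain and, through the factor `1 / ζ`, on the regularity of the mesh. -/
theorem IsPolygonalDomain.exists_sobolev_poincare {Ω : Set Plane} (hΩ : IsPolygonalDomain Ω) :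
    ∃ B : ℝ, 0 < B ∧ ∀ (ι κ : Type) [Fintype ι] [Fintype κ] (𝓜 : AdmissibleMesh Ω ι κ) (ζ : ℝ),
      0 < ζ → 𝓜.IsRegular ζ → ∀ g : ι → ℝ, ∃ c : ℝ, ((∀ K, 0 ≤ g K) → 0 ≤ c) ∧
        ∑ K, 𝓜.area K * (g K - c) ^ 4 ≤ (B / ζ * 𝓜.energy g) ^ 2 := by
  obtain ⟨C, hC, hiso⟩ := hΩ.isoperimetricPair
  set B₀ := (4 * C / volume.real stdTriangle) ^ 2 * volume.real Ω
  have hB₀ : 0 ≤ B₀ := by positivity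
  refine ⟨1 + 2 * B₀, by positivity, fun ι κ _ _ 𝓜 ζ hζ hreg g => ?_⟩
  classical
  have hb := hΩ.isBounded
  have hne : Nonempty ι := by
    obtain ⟨x, hx⟩ := hΩ.isConnected.nonempty
    obtain ⟨K, -⟩ := Set.mem_iUnion.1 (𝓜.subset_iUnion_closure hx)
    exact ⟨K⟩
  obtain ⟨K₀, hgt, hlt⟩ := exists_median 𝓜.area g fun K => (𝓜.area_pos hb K).le
  refine ⟨g K₀, fun h => h K₀, ?_⟩
  have half : ∀ h : ι → ℝ, (∀ K L, |h K - h L| ≤ |g K - g L|) →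
      ∑ K with h K ≠ 0, 𝓜.area K ≤ (∑ K, 𝓜.area K) / 2 →
      ∑ K, 𝓜.area K * h K ^ 4 ≤ B₀ / ζ ^ 2 * 𝓜.energy g ^ 2 := by
    intro h hh hsupp
    refine (𝓜.sum_area_mul_pow_four_le hb hζ hreg hC
      (fun A hA => 𝓜.sum_area_le_mul_perimeter_sq hb hiso A hA) h hsupp).trans ?_
    exact mul_le_mul_of_nonneg_left
      (pow_le_pow_left₀ (𝓜.energy_nonneg h) (𝓜.energy_mono hh) 2) (by positivity)
  have h1 := half (fun K => max (g K - g K₀) 0)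
    (fun K L => (abs_max_sub_max_le_abs _ _ _).trans_eq (by congr 1; ring)) (by
      refine le_trans (le_of_eq ?_) hgt
      congr 1
      ext K
      simp)
  have h2 := half (fun K => max (g K₀ - g K) 0)
    (fun K L => (abs_max_sub_max_le_abs _ _ _).trans_eq (by rw [abs_sub_comm]; congr 1; ring)) (by
      refine le_trans (le_of_eq ?_) hlt
      congr 1
      ext K
      simp)
  have e : ∀ K, 𝓜.area K * (g K - g K₀) ^ 4 = 𝓜.area K * max (g K - g K₀) 0 ^ 4 +
      𝓜.area K * max (g K₀ - g K) 0 ^ 4 := by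
    intro K
    rcases le_total (g K) (g K₀) with h | h
    · rw [max_eq_right (sub_nonpos.2 h), max_eq_left (sub_nonneg.2 h)]; ring
    · rw [max_eq_left (sub_nonneg.2 h), max_eq_right (sub_nonpos.2 h)]; ring
  rw [Finset.sum_congr rfl fun K _ => e K, Finset.sum_add_distrib]
  have hq : 0 ≤ 𝓜.energy g ^ 2 / ζ ^ 2 := by positivity
  have e1 : B₀ / ζ ^ 2 * 𝓜.energy g ^ 2 = B₀ * (𝓜.energy g ^ 2 / ζ ^ 2) := by ring
  have e2 : ((1 + 2 * B₀) / ζ * 𝓜.energy g) ^ 2 =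
      (1 + 2 * B₀) ^ 2 * (𝓜.energy g ^ 2 / ζ ^ 2) := by field_simp
  rw [e1] at h1 h2
  rw [e2]
  nlinarith [mul_nonneg hB₀ hq, mul_nonneg (sq_nonneg B₀) hq]

/-! ### Entropy inequalities for weighted sums -/

lemma Φ_two (s : ℝ) : Φ 2 s = (s - 1) ^ 2 := by
  rw [Φ]; norm_num; ring

lemma Φ₁_le_tangent {s lam : ℝ} (hs : 0 ≤ s) (hl : 0 < lam) :
    Φ₁ s ≤ s * Real.log lam + s ^ 2 / lam - 2 * s + 1 := by
  rcases hs.eq_or_lt with rfl | hs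
  · simp [Φ₁]
  have h := Real.log_le_sub_one_of_pos (div_pos hs hl)
  rw [Real.log_div hs.ne' hl.ne'] at h
  have := mul_le_mul_of_nonneg_left h hs.le
  have e : s * (s / lam - 1) = s ^ 2 / lam - s := by ring
  rw [Φ₁]
  linarith

lemma Φ₁_le_sq {s : ℝ} (hs : 0 ≤ s) : Φ₁ s ≤ (s - 1) ^ 2 := by
  have := Φ₁_le_tangent hs one_pos
  simp only [Real.log_one] at this
  linarith

/-- The Boltzmann entropy generator lies above its tangents. -/
lemma Φ₁_tangent_le {x y : ℝ} (hx : 0 < x) (hy : 0 ≤ y) :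
    Φ₁ x + Real.log x * (y - x) ≤ Φ₁ y := by
  rcases hy.eq_or_lt with rfl | hy
  · simp only [Φ₁]; simp; linarith
  have h := Real.log_le_sub_one_of_pos (div_pos hx hy)
  rw [Real.log_div hx.ne' hy.ne'] at h
  have := mul_le_mul_of_nonneg_left h hy.le
  have e : y * (x / y - 1) = x - y := by field_simp
  simp only [Φ₁]
  linarith

lemma log_sub_hasDerivAt {x : ℝ} (hx : 0 < x) :
    HasDerivAt (fun s : ℝ => Real.log s - (s - 1) * (5 * s + 1) / (2 * s * (s + 2)))
      ((x - 1) ^ 3 / (x ^ 2 * (x + 2) ^ 2)) x := by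
  have h1 : HasDerivAt (fun s : ℝ => (s - 1) * (5 * s + 1))
      (1 * (5 * x + 1) + (x - 1) * (5 * 1)) x :=
    ((hasDerivAt_id x).sub_const 1).mul (((hasDerivAt_id x).const_mul 5).add_const 1)
  have h2 : HasDerivAt (fun s : ℝ => 2 * s * (s + 2))
      (2 * 1 * (x + 2) + 2 * x * 1) x :=
    ((hasDerivAt_id x).const_mul 2).mul ((hasDerivAt_id x).add_const 2)
  have hne : 2 * x * (x + 2) ≠ 0 := by positivity
  refine ((Real.hasDerivAt_log hx.ne').sub (h1.div h2 hne)).congr_deriv ?_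
  have : x + 2 ≠ 0 := by positivity
  field_simp
  ring

/-- A rational lower bound of the logarithm, sharp at `1` to third order. -/
lemma rational_le_log {s : ℝ} (hs : 0 < s) :
    (s - 1) * (5 * s + 1) / (2 * s * (s + 2)) ≤ Real.log s := by
  set F : ℝ → ℝ := fun s => Real.log s - (s - 1) * (5 * s + 1) / (2 * s * (s + 2)) with hF
  have h1 : F 1 = 0 := by simp [hF]
  have hcont : ∀ x : ℝ, 0 < x → ContinuousAt F x := fun x hx =>
    (log_sub_hasDerivAt hx).continuousAt
  have key : 0 ≤ F s := by
    rw [← h1]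
    rcases le_total s 1 with h | h
    · refine antitoneOn_of_deriv_nonpos (convex_Icc s 1)
        (fun x hx => (hcont x (hs.trans_le hx.1)).continuousWithinAt) ?_ ?_
        (Set.left_mem_Icc.2 h) (Set.right_mem_Icc.2 h) h
      · rw [interior_Icc]
        exact fun x hx => (log_sub_hasDerivAt (hs.trans hx.1)).differentiableAt.differentiableWithinAt
      · rw [interior_Icc]
        intro x hx
        rw [(log_sub_hasDerivAt (hs.trans hx.1)).deriv]
        exact div_nonpos_of_nonpos_of_nonneg (Odd.pow_nonpos (by decide) (by linarith [hx.2]))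
          (by positivity)
    · refine monotoneOn_of_deriv_nonneg (convex_Icc 1 s)
        (fun x hx => (hcont x (one_pos.trans_le hx.1)).continuousWithinAt) ?_ ?_
        (Set.left_mem_Icc.2 h) (Set.right_mem_Icc.2 h) h
      · rw [interior_Icc]
        exact fun x hx =>
          (log_sub_hasDerivAt (one_pos.trans hx.1)).differentiableAt.differentiableWithinAt
      · rw [interior_Icc]
        intro x hx
        rw [(log_sub_hasDerivAt (one_pos.trans hx.1)).deriv]
        have : 0 ≤ x - 1 := by linarith [hx.1]
        positivity
  linarith [hF ▸ key]

/-- The pointwise form of Pinsker's inequality. -/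
lemma three_mul_sq_le_Φ₁ {s : ℝ} (hs : 0 ≤ s) : 3 * (s - 1) ^ 2 ≤ (2 * s + 4) * Φ₁ s := by
  rcases hs.eq_or_lt with rfl | hs
  · norm_num [Φ₁]
  have h := rational_le_log hs
  rw [div_le_iff₀ (by positivity)] at h
  rw [Φ₁]
  nlinarith

lemma Φ₁_nonneg {s : ℝ} (hs : 0 ≤ s) : 0 ≤ Φ₁ s := by
  have := three_mul_sq_le_Φ₁ hs
  by_contra h
  nlinarith [sq_nonneg (s - 1)]

/-- The Csiszár–Kullback–Pinsker inequality for weighted finite sums. -/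
lemma sum_abs_sub_sq_le {ι : Type*} [Fintype ι] {w f : ι → ℝ} (hw : ∀ K, 0 ≤ w K)
    (hf : ∀ K, 0 ≤ f K) (hmass : ∑ K, w K * f K = ∑ K, w K) :
    (∑ K, w K * |f K - 1|) ^ 2 ≤ 2 * (∑ K, w K * Φ₁ (f K)) * ∑ K, w K := by
  have h : (∑ K, w K * |f K - 1|) ^ 2 ≤
      (∑ K, w K * Φ₁ (f K)) * ∑ K, w K * ((2 * f K + 4) / 3) := by
    apply Finset.sum_sq_le_sum_mul_sum_of_sq_le_mul
    · exact fun K _ => mul_nonneg (hw K) (Φ₁_nonneg (hf K))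
    · exact fun K _ => mul_nonneg (hw K) (by linarith [hf K])
    · intro K _
      rw [mul_pow, sq_abs]
      have := mul_le_mul_of_nonneg_left (three_mul_sq_le_Φ₁ (hf K)) (sq_nonneg (w K))
      nlinarith
  have e : ∑ K, w K * ((2 * f K + 4) / 3) = 2 * ∑ K, w K := by
    have : ∀ K, w K * ((2 * f K + 4) / 3) = 2 / 3 * (w K * f K) + 4 / 3 * w K := fun K => by ring
    rw [Finset.sum_congr rfl fun K _ => this K, Finset.sum_add_distrib, ← Finset.mul_sum,
      ← Finset.mul_sum, hmass]
    ring
  rw [e] at h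
  linarith

/-- An `L⁴` bound on the distance to a constant controls the variance. -/
lemma sum_weighted_sub_one_sq_le {ι : Type*} [Fintype ι] {m w f : ι → ℝ} {W c S : ℝ}
    (hm : ∀ K, 0 ≤ m K) (hw : ∀ K, 0 < w K) (hwW : ∀ K, w K ≤ W)
    (hmass : ∑ K, m K * w K * f K = ∑ K, m K * w K) (hS : 0 ≤ S) (hW : 0 ≤ W)
    (hc : ∑ K, m K * (f K - c) ^ 4 ≤ S ^ 2) :
    ∑ K, m K * w K * (f K - 1) ^ 2 ≤ W * (√(∑ K, m K) * S) := by
  have hM : 0 ≤ ∑ K, m K := Finset.sum_nonneg fun K _ => hm K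
  have h1 : ∑ K, m K * w K * (f K - 1) ^ 2 ≤ ∑ K, m K * w K * (f K - c) ^ 2 := by
    have e : ∑ K, m K * w K * (f K - c) ^ 2 = ∑ K, m K * w K * (f K - 1) ^ 2 +
        (1 - c) ^ 2 * ∑ K, m K * w K +
        2 * (1 - c) * (∑ K, m K * w K * f K - ∑ K, m K * w K) := by
      rw [← Finset.sum_sub_distrib, Finset.mul_sum, Finset.mul_sum, ← Finset.sum_add_distrib,
        ← Finset.sum_add_distrib]
      exact Finset.sum_congr rfl fun K _ => by ring
    rw [e, hmass, sub_self, mul_zero, add_zero]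
    have : 0 ≤ ∑ K, m K * w K := Finset.sum_nonneg fun K _ => mul_nonneg (hm K) (hw K).le
    nlinarith [mul_nonneg (sq_nonneg (1 - c)) this]
  have h2 : ∑ K, m K * w K * (f K - c) ^ 2 ≤ W * ∑ K, m K * (1 * (f K - c) ^ 2) := by
    rw [Finset.mul_sum]
    refine Finset.sum_le_sum fun K _ => ?_
    have := mul_le_mul_of_nonneg_right (hwW K) (mul_nonneg (hm K) (sq_nonneg (f K - c)))
    linarith
  have h3 : ∑ K, m K * (1 * (f K - c) ^ 2) ≤ √(∑ K, m K) * S := by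
    apply le_of_sq_le_sq _ (by positivity)
    rw [mul_pow, Real.sq_sqrt hM]
    refine (sum_weighted_mul_sq_le Finset.univ (fun K _ => hm K) (fun _ => 1) _).trans ?_
    simp only [one_pow, mul_one]
    refine mul_le_mul_of_nonneg_left (le_trans (le_of_eq ?_) hc) hM
    exact Finset.sum_congr rfl fun K _ => by ring
  exact h1.trans (h2.trans (mul_le_mul_of_nonneg_left h3 hW))

/-- If `g` has unit mean square and is close in `L⁴` to a nonnegative constant `c`, then it is
close to `1`. -/
lemma sum_sub_one_pow_four_le {ι : Type*} [Fintype ι] {μ g : ι → ℝ} {c : ℝ} (hμ : ∀ K, 0 ≤ μ K)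
    (hmass : ∑ K, μ K * g K ^ 2 = ∑ K, μ K) (hc : 0 ≤ c) :
    ∑ K, μ K * (g K - 1) ^ 4 ≤ 16 * ∑ K, μ K * (g K - c) ^ 4 := by
  set M := ∑ K, μ K with hM
  set R := ∑ K, μ K * (g K - c) ^ 4 with hR
  have hM0 : 0 ≤ M := Finset.sum_nonneg fun K _ => hμ K
  have hR0 : 0 ≤ R := Finset.sum_nonneg fun K _ => mul_nonneg (hμ K) (by positivity)
  have hmean : ∑ K, μ K * g K ≤ M := by
    apply le_of_sq_le_sq _ hM0
    have := sum_weighted_mul_sq_le Finset.univ (fun K _ => hμ K) (fun _ => 1) g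
    simp only [one_pow, mul_one, one_mul, hmass] at this
    rw [sq M]
    exact this
  have h1 : (c - 1) ^ 2 * M ≤ ∑ K, μ K * (1 * (g K - c) ^ 2) := by
    have e : ∑ K, μ K * (1 * (g K - c) ^ 2) =
        ∑ K, μ K * g K ^ 2 - 2 * c * ∑ K, μ K * g K + c ^ 2 * M := by
      rw [hM, Finset.mul_sum, Finset.mul_sum, ← Finset.sum_sub_distrib, ← Finset.sum_add_distrib]
      exact Finset.sum_congr rfl fun K _ => by ring
    rw [e, hmass]
    nlinarith
  have h2 : (∑ K, μ K * (1 * (g K - c) ^ 2)) ^ 2 ≤ M * R := by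
    have := sum_weighted_mul_sq_le Finset.univ (fun K _ => hμ K) (fun _ => 1)
      (fun K => (g K - c) ^ 2)
    simp only [one_pow, mul_one] at this
    refine this.trans (le_of_eq ?_)
    congr 1
    exact Finset.sum_congr rfl fun K _ => by ring
  have h3 : (c - 1) ^ 4 * M ≤ R := by
    rcases hM0.eq_or_lt with h0 | h0
    · rw [← h0, mul_zero]; exact hR0
    · have := (pow_le_pow_left₀ (by positivity) h1 2).trans h2
      refine le_of_mul_le_mul_left (le_trans (le_of_eq ?_) this) h0
      ring
  have h4 : ∀ K, μ K * (g K - 1) ^ 4 ≤ 8 * (μ K * (g K - c) ^ 4) + 8 * ((c - 1) ^ 4 * μ K) := by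
    intro K
    have key : (g K - 1) ^ 4 ≤ 8 * (g K - c) ^ 4 + 8 * (c - 1) ^ 4 := by
      have e : g K - 1 = (g K - c) + (c - 1) := by ring
      rw [e]
      generalize g K - c = x
      generalize c - 1 = y
      have a1 : (x + y) ^ 2 ≤ 2 * (x ^ 2 + y ^ 2) := by nlinarith [sq_nonneg (x - y)]
      have a2 := pow_le_pow_left₀ (sq_nonneg _) a1 2
      nlinarith [sq_nonneg (x ^ 2 - y ^ 2)]
    have := mul_le_mul_of_nonneg_left key (hμ K)
    linarith
  have h5 := Finset.sum_le_sum fun K (_ : K ∈ Finset.univ) => h4 K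
  rw [Finset.sum_add_distrib, ← Finset.mul_sum, ← Finset.mul_sum, ← Finset.mul_sum] at h5
  linarith

/-- An `L⁴` bound on the distance to the constant `1` controls the Boltzmann entropy of the
square linearly: by comparison with the quadratic entropy when the distance is small, and by the
concavity of the logarithm when it is large. -/
lemma sum_Φ₁_sq_le {ι : Type*} [Fintype ι] {μ g : ι → ℝ} (hμ : ∀ K, 0 ≤ μ K)
    (hM : 0 < ∑ K, μ K) (hmass : ∑ K, μ K * g K ^ 2 = ∑ K, μ K) :
    ∑ K, μ K * Φ₁ (g K ^ 2) ≤ 17 * √((∑ K, μ K) * ∑ K, μ K * (g K - 1) ^ 4) := by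
  set M := ∑ K, μ K with hMdef
  set Q := ∑ K, μ K * (g K - 1) ^ 4 with hQ
  have hQ0 : 0 ≤ Q := Finset.sum_nonneg fun K _ => mul_nonneg (hμ K) (by positivity)
  rcases le_total Q M with h | h
  · have h1 : ∀ K, μ K * Φ₁ (g K ^ 2) ≤
        8 * (μ K * (1 * (g K - 1) ^ 2)) + 2 * (μ K * (g K - 1) ^ 4) := by
      intro K
      have key : Φ₁ (g K ^ 2) ≤ 8 * (g K - 1) ^ 2 + 2 * (g K - 1) ^ 4 := by
        refine (Φ₁_le_sq (sq_nonneg _)).trans ?_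
        nlinarith [mul_nonneg (sq_nonneg (g K - 1)) (sq_nonneg (g K - 3))]
      have := mul_le_mul_of_nonneg_left key (hμ K)
      linarith
    have h2 := Finset.sum_le_sum fun K (_ : K ∈ Finset.univ) => h1 K
    rw [Finset.sum_add_distrib, ← Finset.mul_sum, ← Finset.mul_sum] at h2
    have h3 : ∑ K, μ K * (1 * (g K - 1) ^ 2) ≤ √(M * Q) := by
      apply Real.le_sqrt_of_sq_le
      have := sum_weighted_mul_sq_le Finset.univ (fun K _ => hμ K) (fun _ => 1)
        (fun K => (g K - 1) ^ 2)
      simp only [one_pow, mul_one] at this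
      refine this.trans (le_of_eq ?_)
      congr 1
      exact Finset.sum_congr rfl fun K _ => by ring
    have h4 : Q ≤ √(M * Q) := by
      apply Real.le_sqrt_of_sq_le
      nlinarith
    have h5 := Real.sqrt_nonneg (M * Q)
    linarith
  · -- this value of `lam` gives the linear and the quartic term of the tangent bound equal size
    set lam := √(Q / M) with hlam
    have hQM : 1 ≤ Q / M := by rwa [one_le_div hM]
    have hl : 0 < lam := Real.sqrt_pos.2 (by linarith)
    have hl2 : lam ^ 2 = Q / M := Real.sq_sqrt (by linarith)
    have hQeq : Q = M * lam ^ 2 := by rw [hl2]; field_simp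
    have hsq : √(M * Q) = M * lam := by
      rw [hQeq, show M * (M * lam ^ 2) = (M * lam) ^ 2 by ring, Real.sqrt_sq (by positivity)]
    have h1 : ∀ K, μ K * Φ₁ (g K ^ 2) ≤ (Real.log lam - 2) * (μ K * g K ^ 2) +
        (1 + 8 / lam) * μ K + 8 / lam * (μ K * (g K - 1) ^ 4) := by
      intro K
      have key : g K ^ 4 ≤ 8 * (g K - 1) ^ 4 + 8 := by
        generalize hx : g K - 1 = x
        have e : g K = x + 1 := by rw [← hx]; ring
        rw [e]
        have a1 : (x + 1) ^ 2 ≤ 2 * (x ^ 2 + 1) := by nlinarith [sq_nonneg (x - 1)]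
        have a2 := pow_le_pow_left₀ (sq_nonneg _) a1 2
        nlinarith [sq_nonneg (x ^ 2 - 1)]
      have h2 := Φ₁_le_tangent (sq_nonneg (g K)) hl
      have h3 : (g K ^ 2) ^ 2 / lam ≤ (8 * (g K - 1) ^ 4 + 8) / lam := by
        rw [← pow_mul]
        exact div_le_div_of_nonneg_right key hl.le
      have := mul_le_mul_of_nonneg_left (h2.trans (add_le_add (sub_le_sub_right
        (add_le_add_right h3 _) _) le_rfl)) (hμ K)
      refine this.trans (le_of_eq ?_)
      ring
    have h2 := Finset.sum_le_sum fun K (_ : K ∈ Finset.univ) => h1 K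
    rw [Finset.sum_add_distrib, Finset.sum_add_distrib, ← Finset.mul_sum, ← Finset.mul_sum,
      ← Finset.mul_sum, hmass] at h2
    change _ ≤ _ * M + _ * M + 8 / lam * Q at h2
    have h3 : Real.log lam ≤ lam - 1 := Real.log_le_sub_one_of_pos hl
    have h4 : 8 / lam * Q = 8 * (M * lam) := by rw [hQeq]; field_simp
    have h5 : 1 ≤ lam := Real.one_le_sqrt.2 hQM
    have h6 : 8 / lam ≤ 8 := div_le_self (by norm_num) h5
    rw [hsq]
    rw [h4] at h2
    nlinarith [mul_le_mul_of_nonneg_right h3 hM.le, mul_le_mul_of_nonneg_right h6 hM.le,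
      mul_le_mul_of_nonneg_right h5 hM.le]

/-- The logarithmic Sobolev step: an `L⁴` bound on the distance to a nonnegative constant controls
the Boltzmann entropy of the square. -/
lemma sum_weighted_Φ₁_sq_le {ι : Type*} [Fintype ι] {m w g : ι → ℝ} {W c S : ℝ}
    (hm : ∀ K, 0 ≤ m K) (hw : ∀ K, 0 < w K) (hwW : ∀ K, w K ≤ W)
    (hM : 0 < ∑ K, m K * w K) (hmass : ∑ K, m K * w K * g K ^ 2 = ∑ K, m K * w K) (hS : 0 ≤ S)
    (hW : 0 ≤ W) (hc0 : 0 ≤ c) (hc : ∑ K, m K * (g K - c) ^ 4 ≤ S ^ 2) :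
    ∑ K, m K * w K * Φ₁ (g K ^ 2) ≤ 68 * √((∑ K, m K * w K) * W) * S := by
  have hμ : ∀ K, 0 ≤ m K * w K := fun K => mul_nonneg (hm K) (hw K).le
  have h1 := sum_Φ₁_sq_le hμ hM hmass
  have h2 := sum_sub_one_pow_four_le hμ hmass hc0
  have h3 : ∑ K, m K * w K * (g K - c) ^ 4 ≤ W * S ^ 2 := by
    refine le_trans ?_ (mul_le_mul_of_nonneg_left hc hW)
    rw [Finset.mul_sum]
    refine Finset.sum_le_sum fun K _ => ?_
    have := mul_le_mul_of_nonneg_right (hwW K)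
      (mul_nonneg (hm K) (by positivity : 0 ≤ (g K - c) ^ 4))
    linarith
  have h4 : √((∑ K, m K * w K) * ∑ K, m K * w K * (g K - 1) ^ 4) ≤
      4 * √((∑ K, m K * w K) * W) * S := by
    apply Real.sqrt_le_iff.2 ⟨by positivity, ?_⟩
    rw [mul_pow, mul_pow, Real.sq_sqrt (by positivity)]
    have := mul_le_mul_of_nonneg_left (h2.trans (mul_le_mul_of_nonneg_left h3 (by norm_num))) hM.le
    linarith
  linarith

/-! ### Entropy dissipation of the scheme -/

lemma two_mul_sq_sqrt_sub_le {a b : ℝ} (ha : 0 < a) (hb : 0 < b) :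
    2 * (√b - √a) ^ 2 ≤ (b - a) * (Real.log b - Real.log a) := by
  wlog hab : a ≤ b generalizing a b
  · have := this hb ha (le_of_not_ge hab)
    linarith
  have hx := Real.sqrt_pos.2 ha
  have hy := Real.sqrt_pos.2 hb
  have hxy := Real.sqrt_le_sqrt hab
  have ea := Real.sq_sqrt ha.le
  have eb := Real.sq_sqrt hb.le
  set x := √a
  set y := √b
  have h := Real.log_le_sub_one_of_pos (div_pos hx hy)
  rw [Real.log_div hx.ne' hy.ne'] at h
  have h' : 1 - x / y ≤ Real.log y - Real.log x := by linarith
  have e1 : Real.log b - Real.log a = 2 * (Real.log y - Real.log x) := by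
    rw [← ea, ← eb, Real.log_pow, Real.log_pow]; push_cast; ring
  rw [e1, ← ea, ← eb]
  have h1 : 0 ≤ y ^ 2 - x ^ 2 := by nlinarith
  have h2 := mul_le_mul_of_nonneg_left h' h1
  have h3 : (y ^ 2 - x ^ 2) * (1 - x / y) = (y - x) ^ 2 * (1 + x / y) := by field_simp; ring
  have h4 : (y - x) ^ 2 ≤ (y - x) ^ 2 * (1 + x / y) :=
    le_mul_of_one_le_right (sq_nonneg _) (by have := div_pos hx hy; linarith)
  linarith

/-- By monotonicity and homogeneity, the mean of the densities `a * wa`, `b * wb` dominates the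
logarithmic mean of the relative densities `a`, `b`. -/
lemma IsMeanFunction.mul_sq_le {r : ℝ → ℝ → ℝ} (hr : IsMeanFunction r) {m a b wa wb : ℝ}
    (hm : 0 < m) (ha : 0 < a) (hb : 0 < b) (hwa : m ≤ wa) (hwb : m ≤ wb) :
    m * (b - a) ^ 2 ≤ r (a * wa) (b * wb) * (Real.log b - Real.log a) * (b - a) ∧
    m * ((b - a) * (Real.log b - Real.log a)) ≤
      r (a * wa) (b * wb) * (Real.log b - Real.log a) * (Real.log b - Real.log a) := by
  rcases eq_or_ne a b with rfl | hab
  · simp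
  have h1 : r (a * m) (b * m) ≤ r (a * wa) (b * wb) :=
    (hr.mono_left _ _ _ (by positivity) (by positivity)
      (mul_le_mul_of_nonneg_left hwa ha.le)).trans
    (hr.mono_right _ _ _ (mul_pos ha (hm.trans_le hwa)) (by positivity)
      (mul_le_mul_of_nonneg_left hwb hb.le))
  rw [mul_comm a m, mul_comm b m, hr.homogeneous m a b hm ha hb] at h1
  have h2 := mul_le_mul_of_nonneg_left (hr.lower a b ha hb hab) hm.le
  have h3 := h2.trans h1
  set D := Real.log b - Real.log a with hD
  have hlog : D ≠ 0 := sub_ne_zero.2 fun h =>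
    hab (Real.log_injOn_pos (Set.mem_Ioi.2 ha) (Set.mem_Ioi.2 hb) h.symm)
  have e : (a - b) / (Real.log a - Real.log b) = (b - a) / D := by
    rw [← neg_sub b a, ← neg_sub (Real.log b), neg_div_neg_eq]
  rw [e] at h3
  have hsign : 0 ≤ D * (b - a) := by
    have := two_mul_sq_sqrt_sub_le ha hb
    nlinarith [sq_nonneg (√b - √a)]
  constructor
  · have h4 := mul_le_mul_of_nonneg_right h3 hsign
    have e2 : m * ((b - a) / D) * (D * (b - a)) = m * (b - a) ^ 2 := by field_simp
    rw [e2] at h4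
    linarith
  · have h4 := mul_le_mul_of_nonneg_right h3 (sq_nonneg D)
    have e2 : m * ((b - a) / D) * D ^ 2 = m * ((b - a) * D) := by field_simp
    rw [e2] at h4
    linarith

/-- Geometric decay of ratio `1 + ν Δt` per step is at least exponential decay of the rate
`log (1 + ν k) / k`, by Bernoulli's inequality. -/
lemma le_mul_exp_of_decay {E : ℕ → ℝ} {ν k Δt : ℝ} (hν : 0 < ν) (hk : 0 < k) (hΔ : 0 < Δt)
    (hΔk : Δt ≤ k) (hE : ∀ n, 0 ≤ E n) (h : ∀ n, E (n + 1) * (1 + ν * Δt) ≤ E n) (n : ℕ) :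
    E n ≤ E 0 * Real.exp (-(expRate ν k * (n * Δt))) := by
  have hpos : 0 < 1 + ν * Δt := by positivity
  have hkpos : 0 < 1 + ν * k := by positivity
  have hrate : Real.exp (expRate ν k * Δt) ≤ 1 + ν * Δt := by
    have hb := rpow_one_add_le_one_add_mul_self (s := ν * k) (p := Δt / k)
      (by nlinarith [mul_pos hν hk]) (by positivity) ((div_le_one hk).2 hΔk)
    rw [Real.rpow_def_of_pos hkpos] at hb
    have e1 : expRate ν k * Δt = Real.log (1 + ν * k) * (Δt / k) := by
      rw [expRate]; ring
    have e2 : 1 + Δt / k * (ν * k) = 1 + ν * Δt := by field_simp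
    rw [e1, ← e2]
    exact hb
  induction n with
  | zero => simp
  | succ n ih =>
    have h1 : E (n + 1) * Real.exp (expRate ν k * Δt) ≤ E n :=
      (mul_le_mul_of_nonneg_left hrate (hE _)).trans (h n)
    have e : Real.exp (-(expRate ν k * ((n + 1 : ℕ) * Δt))) =
        Real.exp (-(expRate ν k * (n * Δt))) * Real.exp (-(expRate ν k * Δt)) := by
      rw [← Real.exp_add]; congr 1; push_cast; ring
    rw [e, ← mul_assoc]
    have h2 := h1.trans ih
    rw [Real.exp_neg (expRate ν k * Δt), ← div_eq_mul_inv, le_div_iff₀ (Real.exp_pos _)]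
    exact h2

namespace AdmissibleMesh

variable {Ω : Set Plane} {ι κ : Type} (𝓜 : AdmissibleMesh Ω ι κ)
  {r : ℝ → ℝ → ℝ} {V u₀ : Plane → ℝ} {w : ι → ℝ}

/-- The flux through an interface is conservative. -/
lemma flux_nbr (hr : IsMeanFunction r) (hw : ∀ K, 0 < w K) (K : ι) (σ : κ) :
    𝓜.flux r V w (𝓜.nbr K σ) σ = -𝓜.flux r V w K σ := by
  rw [flux, flux, diff, diff, nbr_nbr, trans_nbr, hr.symm _ _ (hw (𝓜.nbr K σ)) (hw K)]
  ring

variable [Fintype κ]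

lemma IsSolution.zero_nonneg {u : ℕ → ι → ℝ} {Δt : ℝ} (hu : 𝓜.IsSolution r V u₀ Δt u)
    (h₀ : IsInitialDatum Ω u₀) (K : ι) : 0 ≤ u 0 K := by
  rw [hu.init]
  refine mul_nonneg (one_div_nonneg.2 ENNReal.toReal_nonneg) (setIntegral_nonneg_of_ae_restrict ?_)
  exact ae_restrict_of_ae_restrict_of_subset (𝓜.cell_subset K) h₀.nonneg

lemma IsSolution.nonneg {u : ℕ → ι → ℝ} {Δt : ℝ} (hu : 𝓜.IsSolution r V u₀ Δt u)
    (h₀ : IsInitialDatum Ω u₀) : ∀ n K, 0 ≤ u n K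
  | 0, K => hu.zero_nonneg 𝓜 h₀ K
  | n + 1, K => (hu.pos n K).le

variable [Fintype ι]

/-- Summation by parts for conservative fluxes. -/
lemma sum_mul_flux (hr : IsMeanFunction r) (hw : ∀ K, 0 < w K) (φ : ι → ℝ) :
    ∑ K, φ K * ∑ σ ∈ 𝓜.edges K, 𝓜.flux r V w K σ =
      -(1 / 2) * ∑ K, ∑ σ ∈ 𝓜.edges K, 𝓜.flux r V w K σ * 𝓜.diff φ K σ := by
  have h := 𝓜.sum_edges_swap fun K σ => 𝓜.flux r V w K σ * φ K
  simp only [𝓜.flux_nbr hr hw, neg_mul, Finset.sum_neg_distrib] at h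
  have e : ∑ K, ∑ σ ∈ 𝓜.edges K, 𝓜.flux r V w K σ * 𝓜.diff φ K σ =
      ∑ K, ∑ σ ∈ 𝓜.edges K, 𝓜.flux r V w K σ * φ (𝓜.nbr K σ) -
      ∑ K, ∑ σ ∈ 𝓜.edges K, 𝓜.flux r V w K σ * φ K := by
    rw [← Finset.sum_sub_distrib]
    refine Finset.sum_congr rfl fun K _ => ?_
    rw [← Finset.sum_sub_distrib]
    exact Finset.sum_congr rfl fun σ _ => by rw [diff]; ring
  have e2 : ∑ K, φ K * ∑ σ ∈ 𝓜.edges K, 𝓜.flux r V w K σ =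
      ∑ K, ∑ σ ∈ 𝓜.edges K, 𝓜.flux r V w K σ * φ K := by
    refine Finset.sum_congr rfl fun K _ => ?_
    rw [Finset.mul_sum]
    exact Finset.sum_congr rfl fun σ _ => mul_comm _ _
  rw [e, e2]
  linarith

/-- The steady state is a discrete thermal equilibrium: `log u^∞ + V` takes the same value on both
sides of each interface. -/
lemma IsSteadyState.log_add_eq {uInf : ι → ℝ} (h : 𝓜.IsSteadyState r V u₀ uInf)
    (hr : IsMeanFunction r) {K : ι} {σ : κ} (hσ : σ ∈ 𝓜.edges K) :
    Real.log (uInf (𝓜.nbr K σ)) + V (𝓜.center (𝓜.nbr K σ)) =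
      Real.log (uInf K) + V (𝓜.center K) := by
  have hs := 𝓜.sum_mul_flux (V := V) hr h.pos
    fun J => Real.log (uInf J) + V (𝓜.center J)
  simp only [h.stationary, mul_zero, Finset.sum_const_zero] at hs
  have hterm : ∀ J τ, 0 ≤ 𝓜.trans J τ * r (uInf J) (uInf (𝓜.nbr J τ)) *
      𝓜.diff (fun J => Real.log (uInf J) + V (𝓜.center J)) J τ ^ 2 := fun J τ =>
    mul_nonneg (mul_nonneg (𝓜.trans_nonneg J τ) (hr.pos _ _ (h.pos _) (h.pos _)).le) (sq_nonneg _)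
  have hzero : ∑ J, ∑ τ ∈ 𝓜.edges J, 𝓜.trans J τ * r (uInf J) (uInf (𝓜.nbr J τ)) *
      𝓜.diff (fun J => Real.log (uInf J) + V (𝓜.center J)) J τ ^ 2 = 0 := by
    have e : ∑ J, ∑ τ ∈ 𝓜.edges J, 𝓜.flux r V uInf J τ *
        𝓜.diff (fun J => Real.log (uInf J) + V (𝓜.center J)) J τ =
        -∑ J, ∑ τ ∈ 𝓜.edges J, 𝓜.trans J τ * r (uInf J) (uInf (𝓜.nbr J τ)) *
          𝓜.diff (fun J => Real.log (uInf J) + V (𝓜.center J)) J τ ^ 2 := by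
      simp only [← Finset.sum_neg_distrib]
      refine Finset.sum_congr rfl fun J _ => Finset.sum_congr rfl fun τ _ => ?_
      rw [flux]; ring
    rw [e] at hs
    linarith
  by_cases hn : 𝓜.nbr K σ = K
  · rw [hn]
  have h1 := (Finset.sum_eq_zero_iff_of_nonneg fun J _ =>
    Finset.sum_nonneg fun τ _ => hterm J τ).1 hzero K (Finset.mem_univ K)
  have h2 := (Finset.sum_eq_zero_iff_of_nonneg fun τ _ => hterm K τ).1 h1 σ hσ
  have h3 : 𝓜.trans K σ * r (uInf K) (uInf (𝓜.nbr K σ)) ≠ 0 :=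
    (mul_pos (𝓜.trans_pos hn) (hr.pos _ _ (h.pos _) (h.pos _))).ne'
  have h4 := pow_eq_zero_iff (two_ne_zero) |>.1 ((mul_eq_zero.1 h2).resolve_left h3)
  rw [diff] at h4
  linarith

lemma IsSteadyState.flux_eq {uInf : ι → ℝ} (h : 𝓜.IsSteadyState r V u₀ uInf)
    (hr : IsMeanFunction r) (hw : ∀ K, 0 < w K) {K : ι} {σ : κ} (hσ : σ ∈ 𝓜.edges K) :
    𝓜.flux r V w K σ = -(𝓜.trans K σ * r (w K) (w (𝓜.nbr K σ)) *
      (Real.log (w (𝓜.nbr K σ) / uInf (𝓜.nbr K σ)) - Real.log (w K / uInf K))) := by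
  have e := h.log_add_eq 𝓜 hr hσ
  rw [flux, diff, Real.log_div (hw _).ne' (h.pos _).ne', Real.log_div (hw _).ne' (h.pos _).ne']
  congr 2
  linarith

/-- Entropy dissipation of one step of the scheme, for an entropy generator `Ψ` with derivative
`ψ` that lies above its tangents. -/
lemma entropy_add_dissipation_le {Ψ ψ : ℝ → ℝ} {uInf w₀ : ι → ℝ} {Δt : ℝ}
    (hΨ : ∀ x y, 0 < x → 0 ≤ y → Ψ x + ψ x * (y - x) ≤ Ψ y)
    (hb : Bornology.IsBounded Ω) (h : 𝓜.IsSteadyState r V u₀ uInf) (hr : IsMeanFunction r)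
    (hΔ : 0 < Δt) (hw : ∀ K, 0 < w K) (hw₀ : ∀ K, 0 ≤ w₀ K)
    (hstep : ∀ K, 𝓜.area K * ((w K - w₀ K) / Δt) + ∑ σ ∈ 𝓜.edges K, 𝓜.flux r V w K σ = 0) :
    𝓜.entropy Ψ uInf w + Δt / 2 * ∑ K, ∑ σ ∈ 𝓜.edges K, 𝓜.trans K σ *
      (r (w K) (w (𝓜.nbr K σ)) *
        (Real.log (w (𝓜.nbr K σ) / uInf (𝓜.nbr K σ)) - Real.log (w K / uInf K)) *
        (ψ (w (𝓜.nbr K σ) / uInf (𝓜.nbr K σ)) - ψ (w K / uInf K))) ≤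
      𝓜.entropy Ψ uInf w₀ := by
  have hparts := 𝓜.sum_mul_flux (V := V) hr hw fun K => ψ (w K / uInf K)
  have e1 : ∑ K, ∑ σ ∈ 𝓜.edges K, 𝓜.flux r V w K σ * 𝓜.diff (fun K => ψ (w K / uInf K)) K σ =
      -∑ K, ∑ σ ∈ 𝓜.edges K, 𝓜.trans K σ * (r (w K) (w (𝓜.nbr K σ)) *
        (Real.log (w (𝓜.nbr K σ) / uInf (𝓜.nbr K σ)) - Real.log (w K / uInf K)) *
        (ψ (w (𝓜.nbr K σ) / uInf (𝓜.nbr K σ)) - ψ (w K / uInf K))) := by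
    simp only [← Finset.sum_neg_distrib]
    refine Finset.sum_congr rfl fun K _ => Finset.sum_congr rfl fun σ hσ => ?_
    rw [h.flux_eq 𝓜 hr hw hσ, diff]
    ring
  have e2 : ∀ K, ∑ σ ∈ 𝓜.edges K, 𝓜.flux r V w K σ = -(𝓜.area K * ((w K - w₀ K) / Δt)) :=
    fun K => by linarith [hstep K]
  have e3 : ∑ K, ψ (w K / uInf K) * ∑ σ ∈ 𝓜.edges K, 𝓜.flux r V w K σ =
      1 / Δt * ∑ K, ψ (w K / uInf K) * (𝓜.area K * (w₀ K - w K)) := by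
    rw [Finset.mul_sum]
    refine Finset.sum_congr rfl fun K _ => ?_
    rw [e2]; ring
  rw [e1, e3] at hparts
  have e4 : ∑ K, ψ (w K / uInf K) * (𝓜.area K * (w₀ K - w K)) =
      Δt / 2 * ∑ K, ∑ σ ∈ 𝓜.edges K, 𝓜.trans K σ * (r (w K) (w (𝓜.nbr K σ)) *
        (Real.log (w (𝓜.nbr K σ) / uInf (𝓜.nbr K σ)) - Real.log (w K / uInf K)) *
        (ψ (w (𝓜.nbr K σ) / uInf (𝓜.nbr K σ)) - ψ (w K / uInf K))) := by
    rw [one_div_mul_eq_div, div_eq_iff hΔ.ne'] at hparts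
    rw [hparts]; ring
  rw [← e4, entropy, entropy, ← Finset.sum_add_distrib]
  refine Finset.sum_le_sum fun K _ => ?_
  have hu := h.pos K
  have hmu := mul_pos (𝓜.area_pos hb K) hu
  have h1 := mul_le_mul_of_nonneg_left
    (hΨ (w K / uInf K) (w₀ K / uInf K) (div_pos (hw K) hu) (div_nonneg (hw₀ K) hu.le)) hmu.le
  refine le_trans (le_of_eq ?_) h1
  field_simp

/-- The scheme conserves mass. -/
lemma mass_eq (hr : IsMeanFunction r) {w₀ : ι → ℝ} {Δt : ℝ} (hΔ : 0 < Δt) (hw : ∀ K, 0 < w K)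
    (hstep : ∀ K, 𝓜.area K * ((w K - w₀ K) / Δt) + ∑ σ ∈ 𝓜.edges K, 𝓜.flux r V w K σ = 0) :
    ∑ K, 𝓜.area K * w K = ∑ K, 𝓜.area K * w₀ K := by
  have h := 𝓜.sum_mul_flux (V := V) hr hw fun _ => 1
  simp only [diff, sub_self, mul_zero, Finset.sum_const_zero, one_mul] at h
  have e : ∀ K, ∑ σ ∈ 𝓜.edges K, 𝓜.flux r V w K σ =
      1 / Δt * (𝓜.area K * w₀ K - 𝓜.area K * w K) := fun K => by
    have h1 := hstep K
    have h2 : 𝓜.area K * ((w K - w₀ K) / Δt) =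
      -(1 / Δt * (𝓜.area K * w₀ K - 𝓜.area K * w K)) := by ring
    linarith
  simp only [e] at h
  rw [← Finset.mul_sum, Finset.sum_sub_distrib] at h
  have := (mul_eq_zero.1 h).resolve_left (by positivity)
  linarith

lemma IsSolution.mass {u : ℕ → ι → ℝ} {Δt : ℝ} (hu : 𝓜.IsSolution r V u₀ Δt u)
    (hr : IsMeanFunction r) (hΔ : 0 < Δt) (hb : Bornology.IsBounded Ω)
    (h₀ : IsInitialDatum Ω u₀) (n : ℕ) : ∑ K, 𝓜.area K * u n K = ∫ x in Ω, u₀ x := by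
  induction n with
  | zero =>
    have hfin : IsFiniteMeasure (volume.restrict Ω) :=
      ⟨by rw [Measure.restrict_apply_univ]; exact hb.measure_lt_top⟩
    have hint : IntegrableOn u₀ Ω := h₀.memLp.integrable one_le_two
    rw [← setIntegral_congr_set 𝓜.region_univ_ae_eq, region,
      integral_biUnion_finset _ (fun K _ => (𝓜.cell_isOpen K).measurableSet)
        (fun _ _ _ _ h => 𝓜.disjoint_cell h) (fun K _ => hint.mono_set (𝓜.cell_subset K))]
    refine Finset.sum_congr rfl fun K _ => ?_
    have := (𝓜.area_pos hb K).ne'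
    rw [hu.init]
    field_simp
  | succ n ih =>
    rw [← ih]
    exact 𝓜.mass_eq hr hΔ (hu.pos n) (hu.scheme n)

end AdmissibleMesh

/-! ### Exponential decay -/

namespace AdmissibleMesh

variable {Ω : Set Plane} {ι κ : Type} [Fintype ι] (𝓜 : AdmissibleMesh Ω ι κ)
  {r : ℝ → ℝ → ℝ} {V u₀ : Plane → ℝ} {uInf w w₀ : ι → ℝ} {Δt : ℝ}

/-- The quadratic entropy controls the distance to the steady state in `L²`. -/
lemma sum_sq_le_entropy_two (hb : Bornology.IsBounded Ω) (hpos : ∀ K, 0 < uInf K) {MInf : ℝ}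
    (hbd : ∀ K, uInf K ≤ MInf) :
    ∑ K, 𝓜.area K * |w K - uInf K| ^ 2 ≤ 𝓜.entropy (Φ 2) uInf w * MInf := by
  rw [entropy, Finset.sum_mul]
  refine Finset.sum_le_sum fun K _ => ?_
  have hu := hpos K
  have e : |w K - uInf K| ^ 2 = uInf K * (uInf K * Φ 2 (w K / uInf K)) := by
    rw [sq_abs, Φ_two]; field_simp
  rw [e]
  have hnn : 0 ≤ 𝓜.area K * (uInf K * Φ 2 (w K / uInf K)) := by
    rw [Φ_two]
    exact mul_nonneg (𝓜.area_pos hb K).le (by positivity)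
  have := mul_le_mul_of_nonneg_left (hbd K) hnn
  linarith

/-- The Boltzmann entropy controls the distance to the steady state in `L¹`. -/
lemma sum_abs_sq_le_entropy_one (hb : Bornology.IsBounded Ω) (hpos : ∀ K, 0 < uInf K)
    (hw : ∀ K, 0 ≤ w K) (hmass : ∑ K, 𝓜.area K * w K = ∑ K, 𝓜.area K * uInf K) :
    (∑ K, 𝓜.area K * |w K - uInf K|) ^ 2 ≤
      2 * 𝓜.entropy Φ₁ uInf w * ∑ K, 𝓜.area K * uInf K := by
  have h := sum_abs_sub_sq_le (w := fun K => 𝓜.area K * uInf K) (f := fun K => w K / uInf K)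
    (fun K => mul_nonneg (𝓜.area_pos hb K).le (hpos K).le)
    (fun K => div_nonneg (hw K) (hpos K).le) (by
      rw [← hmass]
      refine Finset.sum_congr rfl fun K _ => ?_
      have := (hpos K).ne'
      field_simp)
  refine le_trans (le_of_eq ?_) h
  congr 1
  refine Finset.sum_congr rfl fun K _ => ?_
  have hu := hpos K
  have e : w K - uInf K = uInf K * (w K / uInf K - 1) := by field_simp
  rw [e, abs_mul, abs_of_pos hu, mul_assoc]

variable [Fintype κ]

/-- One step of the scheme contracts the quadratic entropy. -/
lemma entropy_two_step {B ζ mInf MInf : ℝ} (hB : 0 < B) (hζ : 0 < ζ)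
    (hsob : ∀ g : ι → ℝ, ∃ c : ℝ, ((∀ K, 0 ≤ g K) → 0 ≤ c) ∧
      ∑ K, 𝓜.area K * (g K - c) ^ 4 ≤ (B / ζ * 𝓜.energy g) ^ 2)
    (hb : Bornology.IsBounded Ω) (hΩ : 0 < volume.real Ω) (h : 𝓜.IsSteadyState r V u₀ uInf)
    (hr : IsMeanFunction r) (hΔ : 0 < Δt) (hw : ∀ K, 0 < w K) (hw₀ : ∀ K, 0 ≤ w₀ K)
    (hstep : ∀ K, 𝓜.area K * ((w K - w₀ K) / Δt) + ∑ σ ∈ 𝓜.edges K, 𝓜.flux r V w K σ = 0)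
    (hmass : ∑ K, 𝓜.area K * w K = ∑ K, 𝓜.area K * uInf K)
    (hm : 0 < mInf) (hM : 0 < MInf) (hbd : ∀ K, mInf ≤ uInf K ∧ uInf K ≤ MInf) :
    𝓜.entropy (Φ 2) uInf w * (1 + mInf / MInf * ζ / (√(volume.real Ω) * B) * Δt) ≤
      𝓜.entropy (Φ 2) uInf w₀ := by
  have hpos := h.pos
  set f : ι → ℝ := fun K => w K / uInf K with hf
  have hf0 : ∀ K, 0 < f K := fun K => div_pos (hw K) (hpos K)
  have hwf : ∀ K, f K * uInf K = w K := fun K => div_mul_cancel₀ _ (hpos K).ne'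
  have hdiss := 𝓜.entropy_add_dissipation_le (Ψ := Φ 2) (ψ := fun s => 2 * (s - 1))
    (fun x y _ _ => by rw [Φ_two, Φ_two]; nlinarith [sq_nonneg (y - x)]) hb h hr hΔ hw hw₀ hstep
  have hD : 2 * mInf * 𝓜.energy f ≤ ∑ K, ∑ σ ∈ 𝓜.edges K, 𝓜.trans K σ *
      (r (w K) (w (𝓜.nbr K σ)) * (Real.log (f (𝓜.nbr K σ)) - Real.log (f K)) *
        (2 * (f (𝓜.nbr K σ) - 1) - 2 * (f K - 1))) := by
    rw [energy, Finset.mul_sum]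
    refine Finset.sum_le_sum fun K _ => ?_
    rw [Finset.mul_sum]
    refine Finset.sum_le_sum fun σ _ => ?_
    have h1 := (hr.mul_sq_le hm (hf0 K) (hf0 (𝓜.nbr K σ)) (hbd K).1 (hbd (𝓜.nbr K σ)).1).1
    rw [hwf, hwf] at h1
    have h2 := mul_le_mul_of_nonneg_left h1 (𝓜.trans_nonneg K σ)
    rw [diff]
    linarith
  obtain ⟨c, -, hc⟩ := hsob f
  have hE := 𝓜.energy_nonneg f
  have hP := sum_weighted_sub_one_sq_le (fun K => (𝓜.area_pos hb K).le) hpos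
    (fun K => (hbd K).2) (f := f) (by
      rw [← hmass]
      exact Finset.sum_congr rfl fun K _ => by rw [mul_assoc, mul_comm (uInf K), hwf])
    (by positivity) hM.le hc
  have hent : 𝓜.entropy (Φ 2) uInf w = ∑ K, 𝓜.area K * uInf K * (f K - 1) ^ 2 := by
    rw [entropy]
    exact Finset.sum_congr rfl fun K _ => by rw [Φ_two]
  rw [𝓜.sum_area hb, ← hent] at hP
  have hs : 0 < √(volume.real Ω) := Real.sqrt_pos.2 hΩ
  set ν := mInf / MInf * ζ / (√(volume.real Ω) * B) with hν
  have hνE : ν * 𝓜.entropy (Φ 2) uInf w ≤ mInf * 𝓜.energy f := by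
    refine (mul_le_mul_of_nonneg_left hP (by positivity)).trans (le_of_eq ?_)
    rw [hν]
    field_simp
  have h1 := mul_le_mul_of_nonneg_left hD (half_pos hΔ).le
  have h2 := mul_le_mul_of_nonneg_left hνE hΔ.le
  linarith

/-- One step of the scheme contracts the Boltzmann entropy. -/
lemma entropy_one_step {B ζ M1 mInf MInf : ℝ} (hB : 0 < B) (hζ : 0 < ζ)
    (hsob : ∀ g : ι → ℝ, ∃ c : ℝ, ((∀ K, 0 ≤ g K) → 0 ≤ c) ∧
      ∑ K, 𝓜.area K * (g K - c) ^ 4 ≤ (B / ζ * 𝓜.energy g) ^ 2)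
    (hb : Bornology.IsBounded Ω) (h : 𝓜.IsSteadyState r V u₀ uInf)
    (hr : IsMeanFunction r) (hΔ : 0 < Δt) (hw : ∀ K, 0 < w K) (hw₀ : ∀ K, 0 ≤ w₀ K)
    (hstep : ∀ K, 𝓜.area K * ((w K - w₀ K) / Δt) + ∑ σ ∈ 𝓜.edges K, 𝓜.flux r V w K σ = 0)
    (hmass : ∑ K, 𝓜.area K * w K = ∑ K, 𝓜.area K * uInf K)
    (hM1 : ∑ K, 𝓜.area K * uInf K = M1) (hM1pos : 0 < M1)
    (hm : 0 < mInf) (hM : 0 < MInf) (hbd : ∀ K, mInf ≤ uInf K ∧ uInf K ≤ MInf) :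
    𝓜.entropy Φ₁ uInf w * (1 + mInf * ζ / (68 * √(M1 * MInf) * B) * Δt) ≤
      𝓜.entropy Φ₁ uInf w₀ := by
  have hpos := h.pos
  set f : ι → ℝ := fun K => w K / uInf K with hf
  have hf0 : ∀ K, 0 < f K := fun K => div_pos (hw K) (hpos K)
  have hwf : ∀ K, f K * uInf K = w K := fun K => div_mul_cancel₀ _ (hpos K).ne'
  have hdiss := 𝓜.entropy_add_dissipation_le (Ψ := Φ₁) (ψ := Real.log)
    (fun x y hx hy => Φ₁_tangent_le hx hy) hb h hr hΔ hw hw₀ hstep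
  have hD : 2 * mInf * 𝓜.energy (fun K => √(f K)) ≤ ∑ K, ∑ σ ∈ 𝓜.edges K, 𝓜.trans K σ *
      (r (w K) (w (𝓜.nbr K σ)) * (Real.log (f (𝓜.nbr K σ)) - Real.log (f K)) *
        (Real.log (f (𝓜.nbr K σ)) - Real.log (f K))) := by
    rw [energy, Finset.mul_sum]
    refine Finset.sum_le_sum fun K _ => ?_
    rw [Finset.mul_sum]
    refine Finset.sum_le_sum fun σ _ => ?_
    have h1 := (hr.mul_sq_le hm (hf0 K) (hf0 (𝓜.nbr K σ)) (hbd K).1 (hbd (𝓜.nbr K σ)).1).2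
    rw [hwf, hwf] at h1
    have h2 := mul_le_mul_of_nonneg_left (two_mul_sq_sqrt_sub_le (hf0 K) (hf0 (𝓜.nbr K σ))) hm.le
    have h3 := mul_le_mul_of_nonneg_left (h2.trans h1) (𝓜.trans_nonneg K σ)
    rw [diff]
    linarith
  obtain ⟨c, hc0, hc⟩ := hsob fun K => √(f K)
  have hE := 𝓜.energy_nonneg fun K => √(f K)
  have hsq : ∀ K, √(f K) ^ 2 = f K := fun K => Real.sq_sqrt (hf0 K).le
  have hP := sum_weighted_Φ₁_sq_le (fun K => (𝓜.area_pos hb K).le) hpos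
    (fun K => (hbd K).2) (hM1.symm ▸ hM1pos) (g := fun K => √(f K)) (by
      rw [← hmass]
      exact Finset.sum_congr rfl fun K _ => by rw [hsq, mul_assoc, mul_comm (uInf K), hwf])
    (by positivity) hM.le (hc0 fun K => Real.sqrt_nonneg _) hc
  simp only [hsq] at hP
  rw [hM1] at hP
  change 𝓜.entropy Φ₁ uInf w ≤ _ at hP
  have hs : 0 < √(M1 * MInf) := Real.sqrt_pos.2 (by positivity)
  set ν := mInf * ζ / (68 * √(M1 * MInf) * B) with hν
  have hνE : ν * 𝓜.entropy Φ₁ uInf w ≤ mInf * 𝓜.energy fun K => √(f K) := by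
    refine (mul_le_mul_of_nonneg_left hP (by positivity)).trans (le_of_eq ?_)
    rw [hν]
    field_simp
  have h1 := mul_le_mul_of_nonneg_left hD (half_pos hΔ).le
  have h2 := mul_le_mul_of_nonneg_left hνE hΔ.le
  linarith

end AdmissibleMesh

end TPFA

theorem corollary3p1 (Ω : Set TPFA.Plane) (hΩ : TPFA.IsPolygonalDomain Ω) :
    ∃ (ν₁ : ℝ → ℝ → ℝ → ℝ → ℝ) (ν₂ : ℝ → ℝ → ℝ),
      (∀ ζ M1 mInf MInf : ℝ, 0 < ζ → 0 < M1 → 0 < mInf → 0 < MInf → 0 < ν₁ ζ M1 mInf MInf) ∧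
      (∀ ζ q : ℝ, 0 < ζ → 0 < q → 0 < ν₂ ζ q) ∧
      ∀ (ι κ : Type) [Fintype ι] [Fintype κ] (𝓜 : TPFA.AdmissibleMesh Ω ι κ)
        (ζ : ℝ), 0 < ζ → 𝓜.IsRegular ζ →
      ∀ r : ℝ → ℝ → ℝ, TPFA.IsMeanFunction r →
      ∀ V : TPFA.Plane → ℝ, TPFA.IsC1Closure Ω V →
      ∀ u₀ : TPFA.Plane → ℝ, TPFA.IsInitialDatum Ω u₀ →
      ∀ M1 : ℝ, M1 = ∫ x in Ω, u₀ x →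
      ∀ uInf : ι → ℝ, 𝓜.IsSteadyState r V u₀ uInf →
      ∀ mInf MInf : ℝ, 0 < mInf → (∀ K, mInf ≤ uInf K ∧ uInf K ≤ MInf) →
      ∀ Δt : ℝ, 0 < Δt →
      ∀ u : ℕ → ι → ℝ, 𝓜.IsSolution r V u₀ Δt u →
      ∀ k : ℝ, 0 < k → Δt ≤ k →
      ∀ n : ℕ,
        ∑ K, 𝓜.area K * |u n K - uInf K| ^ 2 ≤
            𝓜.entropy (TPFA.Φ 2) uInf (u 0) * MInf *
              Real.exp (-(TPFA.expRate (ν₂ ζ (mInf / MInf)) k * (n * Δt))) ∧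
        (∑ K, 𝓜.area K * |u n K - uInf K|) ^ 2 ≤
            2 * 𝓜.entropy TPFA.Φ₁ uInf (u 0) * M1 *
              Real.exp (-(TPFA.expRate (ν₁ ζ M1 mInf MInf) k * (n * Δt))) := by
  obtain ⟨B, hB, hsob⟩ := hΩ.exists_sobolev_poincare
  have hb := hΩ.isBounded
  have hvol : 0 < volume.real Ω := ENNReal.toReal_pos
    (hΩ.isOpen.measure_pos volume hΩ.isConnected.nonempty).ne' hb.measure_lt_top.ne
  have hs : 0 < √(volume.real Ω) := Real.sqrt_pos.2 hvol
  refine ⟨fun ζ M1 mInf MInf => mInf * ζ / (68 * √(M1 * MInf) * B),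
    fun ζ q => q * ζ / (√(volume.real Ω) * B), fun ζ M1 mInf MInf hζ hM1 hm hM => by positivity,
    fun ζ q hζ hq => by positivity, ?_⟩
  intro ι κ _ _ 𝓜 ζ hζ hreg r hr V _ u₀ hu₀ M1 hM1 uInf hInf mInf MInf hm hbd Δt hΔ u hu k hk hΔk n
  have hM1pos : 0 < M1 := hM1 ▸ hu₀.mass_pos
  have hM : 0 < MInf := by
    obtain ⟨x, hx⟩ := hΩ.isConnected.nonempty
    obtain ⟨K, -⟩ := Set.mem_iUnion.1 (𝓜.subset_iUnion_closure hx)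
    exact hm.trans_le ((hbd K).1.trans (hbd K).2)
  have hmassInf : ∑ K, 𝓜.area K * uInf K = M1 := hInf.mass.trans hM1.symm
  have hmass : ∀ n, ∑ K, 𝓜.area K * u n K = ∑ K, 𝓜.area K * uInf K := fun n =>
    (hu.mass 𝓜 hr hΔ hb hu₀ n).trans hInf.mass.symm
  have hunn := hu.nonneg 𝓜 hu₀
  have hsob' := hsob ι κ 𝓜 ζ hζ hreg
  constructor
  · have hdecay := TPFA.le_mul_exp_of_decay (E := fun n => 𝓜.entropy (TPFA.Φ 2) uInf (u n))
      (ν := mInf / MInf * ζ / (√(volume.real Ω) * B)) (by positivity) hk hΔ hΔk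
      (fun n => Finset.sum_nonneg fun K _ => by
        rw [TPFA.Φ_two]
        exact mul_nonneg (mul_nonneg (𝓜.area_pos hb K).le (hInf.pos K).le) (sq_nonneg _))
      (fun n => 𝓜.entropy_two_step hB hζ hsob' hb hvol hInf hr hΔ (hu.pos n) (hunn n)
        (hu.scheme n) (hmass (n + 1)) hm hM hbd) n
    refine (𝓜.sum_sq_le_entropy_two hb hInf.pos fun K => (hbd K).2).trans
      ((mul_le_mul_of_nonneg_right hdecay hM.le).trans (le_of_eq ?_))
    ring
  · have hdecay := TPFA.le_mul_exp_of_decay (E := fun n => 𝓜.entropy TPFA.Φ₁ uInf (u n))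
      (ν := mInf * ζ / (68 * √(M1 * MInf) * B)) (by positivity) hk hΔ hΔk
      (fun n => Finset.sum_nonneg fun K _ =>
        mul_nonneg (mul_nonneg (𝓜.area_pos hb K).le (hInf.pos K).le)
          (TPFA.Φ₁_nonneg (div_nonneg (hunn n K) (hInf.pos K).le)))
      (fun n => 𝓜.entropy_one_step hB hζ hsob' hb hInf hr hΔ (hu.pos n) (hunn n)
        (hu.scheme n) (hmass (n + 1)) hmassInf hM1pos hm hM hbd) n
    have h := 𝓜.sum_abs_sq_le_entropy_one hb hInf.pos (hunn n) (hmass n)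
    rw [hmassInf] at h
    refine h.trans ((mul_le_mul_of_nonneg_right
      (mul_le_mul_of_nonneg_left hdecay zero_le_two) hM1pos.le).trans (le_of_eq ?_))
    ring
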